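/- **Setting.** Let $\Omega\subset\mathbb R^2$ be nonempty, bounded and open with boundary of class $C^2$, with outward unit normal $\nu$, unit tangent $\tau$ (the rotation of $\nu$ by $+90^\circ$), curvature $\kappa=\partial_\tau\nu\cdot\tau$ and arc length $ds$. Let $f\in C^2(\mathbb R^2)$, let $J(\Omega)=\int_\Omega f\,dx$, and assume $\nabla f\cdot\nu+\kappa f>0$ on $\partial\Omega$. *Shape derivatives.* For compactly supported $C^1$ vector fields $X,Y$ on $\mathbb R^2$, $$DJ(\Omega)(X)=\lim_{t\to0^+}\frac{J((\mathrm{id}+tX)(\Omega))-J(\Omega)}{t},$$ $$\mathfrak D^2J(\Omega)(X)(Y)=\lim_{t\to0^+}\frac{DJ((\mathrm{id}+tY)(\Omega))(X\circ(\mathrm{id}+tY)^{-1})-DJ(\Omega)(X)}{t}.$$ For vector fields given only on $\partial\Omega$ these expressions are understood through compactly supported $C^1$ extensions to $\mathbb R^2$; an equation between shape derivatives includes that such extensions and the limits exist. *Kernel.* Let $k\ge1$ be an integer such that $\partial\Omega$ is of class $C^{k+1}$, and let $\mathsf k:\mathbb R^2\times\mathbb R^2\to\mathbb R$ be symmetric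 and positive definite (the matrices $(\mathsf k(x_i,x_j))_{i,j}$ for pairwise distinct points are positive definite), with $\mathsf k(x,\cdot)\in C^k(\mathbb R^2)$ for all $x$ and $\mathsf k(x,x)=1$ for $x\in\partial\Omega$. Let $\mathcal H=\mathcal H(\partial\Omega)$ be the reproducing kernel Hilbert space of $\mathsf k|_{\partial\Omega\times\partial\Omega}$. Assume that there is $c_\Omega>0$ such that $\phi g\in\mathcal H$ and $\|\phi g\|_{\mathcal H}\le c_\Omega\|\phi\|_{C^k(\partial\Omega)}\|g\|_{\mathcal H}$ for all $\phi\in C^k(\partial\Omega)$, $g\in\mathcal H$, and that the two coordinate functions belong to $\mathcal H$. Let $[\mathcal H]^2_\nu=\{v\in\mathcal H^2: v\cdot\tau=0\text{ on }\partial\Omega\}$. *Basis functions.* For $x\in\partial\Omega$ let $(r_x,p_x)\in\mathcal H^2\times\mathcal H$ be the solution of $$(r_x,\varphi)_{\mathcal H^2}+(\varphi\cdot\tau,p_x)_{\mathcal H}=\nu(x)\cdot\varphi(x)\ \ \forall\varphi\in\mathcal H^2,\qquad (r_x\cdot\tau,\psi)_{\mathcal H}=0\ \ \forall\psi\in\mathcal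 H.$$ For a finite set $\mathcal X_N\subset\partial\Omega$ put $\mathcal R_N=\mathrm{span}\{r_x:x\in\mathcal X_N\}$. *Newton directions.* A Newton direction in $[\mathcal H]^2_\nu$ is a solution $X\in[\mathcal H]^2_\nu$ of $$\mathfrak D^2J(\Omega)(X)(Y)=-DJ(\Omega)(Y)\quad\forall Y\in[\mathcal H]^2_\nu.$$ A discrete Newton direction is a solution $X_\nu^h\in\mathcal R_N$ of $$\mathfrak D^2J(\Omega)(X_\nu^h)(Y)=-DJ(\Omega)(Y)\quad\forall Y\in\mathcal R_N.$$ **Proposition.** There is a constant $c_{f,\Omega}>0$, depending only on $f$ and $\Omega$, such that for all $k$, $\mathsf k$ and $\mathcal X_N$ as above: 1. Every Newton direction in $[\mathcal H]^2_\nu$ equals $-\dfrac{f}{\nabla f\cdot\nu+\kappa f}\,\nu$ on $\partial\Omega$. 2. If every element of $\mathcal R_N$ has a compactly supported $C^1$ extension to $\mathbb R^2$, then there is exactly one discrete Newton direction $X_\nu^h\in\mathcal R_N$. 3. Let $X_\nu^h\in\mathcal R_N$ be a discrete Newton direction, and let $X_\nu$ be a Newton direction in $[\mathcal H]^2_\nu$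 or, whether or not one exists, the field $-\frac{f}{\nabla f\cdot\nu+\kappa f}\,\nu$. Then $X_\nu\in L_2(\partial\Omega)$ and $$\|X_\nu-X_\nu^h\|_{L_2(\partial\Omega)}\le c_{f,\Omega}\inf_{Y\in\mathcal R_N}\|X_\nu-Y\|_{L_2(\partial\Omega)}.$$ -/

import Mathlib

open MeasureTheory Filter Topology Set
open scoped RealInnerProductSpace ENNReal

noncomputable section

namespace ShapeNewton

/-- The Euclidean plane. -/
abbrev Plane : Type := EuclideanSpace ℝ (Fin 2)

/-- Counterclockwise rotation by a right angle. -/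
def rot (v : Plane) : Plane := !₂[-v 1, v 0]

/-! ### Domains with `C^m` boundary -/

/-- In the ball of radius `r` around `p`, and in the Cartesian coordinates
`(⟪x, rot e⟫, ⟪x, e⟫)`, the set `Ω` is the region strictly below the graph of the
`C^m` function `g`. -/
structure IsLocalGraph (m : ℕ) (Ω : Set Plane) (p e : Plane) (g : ℝ → ℝ) (r : ℝ) : Prop where
  unit : ‖e‖ = 1
  pos : 0 < r
  smooth : ContDiff ℝ m g
  below : ∀ x ∈ Metric.ball p r, x ∈ Ω ↔ ⟪x, e⟫ < g ⟪x, rot e⟫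

/-- The boundary of `Ω` is of class `C^m`, with `Ω` locally on one side of it. -/
def HasCmBoundary (m : ℕ) (Ω : Set Plane) : Prop :=
  ∀ p ∈ frontier Ω, ∃ e g r, IsLocalGraph m Ω p e g r

/-- `n` is the outward unit normal of `Ω` at the boundary point `p`: the normalisation of the
upward normal of a graph that describes `Ω` near `p`. -/
def IsOuterUnitNormal (Ω : Set Plane) (p n : Plane) : Prop :=
  ∃ e g r, IsLocalGraph 1 Ω p e g r ∧
    n = (‖e - deriv g ⟪p, rot e⟫ • rot e‖)⁻¹ • (e - deriv g ⟪p, rot e⟫ • rot e)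

open Classical in
/-- The outward unit normal field `ν` along `∂Ω`. -/
def normal (Ω : Set Plane) (p : Plane) : Plane :=
  if h : ∃ n, IsOuterUnitNormal Ω p n then h.choose else 0

/-- The unit tangent field `τ` along `∂Ω`. -/
def tangent (Ω : Set Plane) (p : Plane) : Plane := rot (normal Ω p)

/-- The curvature `κ = ∂_τ ν · τ` of `∂Ω`. (A derivative within `∂Ω` is determined in tangential
directions; the curvature of a disc of radius `R` is `1 / R`.) -/
def curvature (Ω : Set Plane) (p : Plane) : ℝ :=
  ⟪fderivWithin ℝ (normal Ω) (frontier Ω) p (tangent Ω p), tangent Ω p⟫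

/-- The arc length measure on `∂Ω`. -/
def arcLength (Ω : Set Plane) : Measure (frontier Ω) :=
  (Measure.hausdorffMeasure 1 : Measure Plane).comap Subtype.val

/-! ### The space `C^k(∂Ω)` -/

/-- The restriction of `φ` to `∂Ω` is of class `C^k`. -/
def IsCkOnBoundary (k : ℕ) (Ω : Set Plane) (φ : Plane → ℝ) : Prop :=
  ∀ p ∈ frontier Ω, ∃ Φ : Plane → ℝ, ContDiff ℝ k Φ ∧ ∀ᶠ x in 𝓝[frontier Ω] p, φ x = Φ x

/-- The derivative along `∂Ω` with respect to arc length. -/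
def tangentialDeriv (Ω : Set Plane) (φ : Plane → ℝ) (p : Plane) : ℝ :=
  fderivWithin ℝ φ (frontier Ω) p (tangent Ω p)

/-- The `C^k(∂Ω)` norm: the maximum of the suprema over `∂Ω` of the arc length derivatives of
order at most `k`. -/
def ckNorm (k : ℕ) (Ω : Set Plane) (φ : Plane → ℝ) : ℝ :=
  ⨆ j : Fin (k + 1), ⨆ p : frontier Ω, |(tangentialDeriv Ω)^[j] φ p|

/-! ### Shape derivatives -/

/-- The perturbation of identity `id + t X`. -/
def perturb (X : Plane → Plane) (t : ℝ) (x : Plane) : Plane := x + t • X x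

/-- The directional derivative of the shape function `J` at `Ω` in the direction `X` exists and
equals `d`. -/
def HasShapeDeriv (J : Set Plane → ℝ) (Ω : Set Plane) (X : Plane → Plane) (d : ℝ) : Prop :=
  Tendsto (fun t : ℝ => (J (perturb X t '' Ω) - J Ω) / t) (𝓝[>] 0) (𝓝 d)

/-- The second directional derivative of the shape function `J` at `Ω` in the direction
`(X, Y)`, that is, the derivative at `t = 0` of `t ↦ DJ((id + tY)(Ω))(X ∘ (id + tY)⁻¹)`,
exists and equals `l`. -/
def HasShapeDeriv₂ (J : Set Plane → ℝ) (Ω : Set Plane) (X Y : Plane → Plane) (l : ℝ) : Prop :=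
  ∃ (d₀ : ℝ) (d : ℝ → ℝ), HasShapeDeriv J Ω X d₀ ∧
    (∀ᶠ t in 𝓝[>] (0 : ℝ),
      HasShapeDeriv J (perturb Y t '' Ω) (X ∘ Function.invFun (perturb Y t)) (d t)) ∧
    Tendsto (fun t : ℝ => (d t - d₀) / t) (𝓝[>] 0) (𝓝 l)

/-- `V` is a compactly supported `C^1` vector field on the plane that extends the vector
field `v` given on `∂Ω`. -/
structure IsC1Extension {Ω : Set Plane} (v : frontier Ω → Plane) (V : Plane → Plane) : Prop where
  smooth : ContDiff ℝ 1 V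
  compact : HasCompactSupport V
  extend : ∀ p : frontier Ω, V p = v p

/-- `DJ(Ω)(v) = d` for a vector field `v` on `∂Ω`. -/
def HasBoundaryShapeDeriv (J : Set Plane → ℝ) {Ω : Set Plane} (v : frontier Ω → Plane)
    (d : ℝ) : Prop :=
  ∃ V, IsC1Extension v V ∧ HasShapeDeriv J Ω V d

/-- `D²J(Ω)(v)(w) = l` for vector fields `v`, `w` on `∂Ω`. -/
def HasBoundaryShapeDeriv₂ (J : Set Plane → ℝ) {Ω : Set Plane} (v w : frontier Ω → Plane)
    (l : ℝ) : Prop :=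
  ∃ V W, IsC1Extension v V ∧ IsC1Extension w W ∧ HasShapeDeriv₂ J Ω V W l

/-- The shape function `J(Ω) = ∫_Ω f dx`. -/
def shapeIntegral (f : Plane → ℝ) (Ω : Set Plane) : ℝ := ∫ x in Ω, f x

/-- The function `∇f · ν + κ f` on `∂Ω`. -/
def hessianWeight (f : Plane → ℝ) (Ω : Set Plane) (p : Plane) : ℝ :=
  ⟪gradient f p, normal Ω p⟫ + curvature Ω p * f p

/-- The vector field `-f / (∇f · ν + κ f) ν` on `∂Ω`. -/
def explicitDirection (f : Plane → ℝ) (Ω : Set Plane) (p : frontier Ω) : Plane :=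
  -(f p / hessianWeight f Ω p) • normal Ω p

/-! ### The reproducing kernel Hilbert space on the boundary -/

section RKHS

variable {Ω : Set Plane} {H : Type*} [NormedAddCommGroup H] [InnerProductSpace ℝ H]
  [RKHS ℝ H (frontier Ω) ℝ]

/-- The standing assumptions on the kernel `K` on the plane; `H` is the reproducing kernel
Hilbert space on `∂Ω` of the restriction of `K` to `∂Ω`. -/
structure KernelAssumption [CompleteSpace H] (k : ℕ) (K : Plane → Plane → ℝ) : Prop where
  symm : ∀ x y, K x y = K y x
  posDef : ∀ s : Finset Plane, (Matrix.of fun x y : s => K x y).PosDef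
  diag : ∀ x ∈ frontier Ω, K x x = 1
  smooth : ∀ x, ContDiff ℝ k (K x)
  kernel_eq : ∀ x y : frontier Ω, RKHS.kernel H x y 1 = K x y
  module : ∃ c : ℝ, 0 < c ∧ ∀ φ : Plane → ℝ, IsCkOnBoundary k Ω φ → ∀ f : H,
    ∃ g : H, (∀ p : frontier Ω, g p = φ p * f p) ∧ ‖g‖ ≤ c * ckNorm k Ω φ * ‖f‖
  identity : ∀ i : Fin 2, ∃ g : H, ∀ p : frontier Ω, g p = (p : Plane) i

variable (H) in
/-- The Hilbert space `[H(∂Ω)]²`. -/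
abbrev Sq : Type _ := PiLp 2 (fun _ : Fin 2 => H)

/-- The vector field on `∂Ω` given by an element of `[H(∂Ω)]²`. -/
def field (F : Sq H) (p : frontier Ω) : Plane := WithLp.toLp 2 (fun i => F i p)

variable (H) in
/-- The space `[H(∂Ω)]²_ν` of normal vector fields. -/
def normalFields : Submodule ℝ (Sq H) where
  carrier := {F | ∀ p : frontier Ω, ⟪field F p, tangent Ω p⟫ = 0}
  add_mem' {F G} hF hG p := by
    have h : field (F + G) p = field F p + field G p := by
      ext i; simp [field]
    rw [h, inner_add_left, hF p, hG p, add_zero]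
  zero_mem' p := by
    have h : field (0 : Sq H) p = 0 := by
      ext i; simp [field]
    rw [h, inner_zero_left]
  smul_mem' a F hF p := by
    have h : field (a • F) p = a • field F p := by
      ext i; simp [field]
    rw [h, inner_smul_left, hF p, mul_zero]

/-- `(r, q)` solves the saddle point problem that defines the weakly-normal basis function `r`
at the boundary point `x`. An element `g` of `H(∂Ω)` with `g = φ · τ` on `∂Ω` is unique, and it
exists under the module property of the kernel assumptions. -/
structure IsSaddlePoint (x : frontier Ω) (r : Sq H) (q : H) : Prop where
  first : ∀ (φ : Sq H) (g : H), (∀ y : frontier Ω, g y = ⟪field φ y, tangent Ω y⟫) →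
    ⟪r, φ⟫ + ⟪g, q⟫ = ⟪normal Ω x, field φ x⟫
  second : ∀ (ψ g : H), (∀ y : frontier Ω, g y = ⟪field r y, tangent Ω y⟫) → ⟪g, ψ⟫ = 0

variable (H) in
/-- The span `R_N` of the weakly-normal basis functions at the points of the finite set `S`. -/
def basisSpan (S : Finset (frontier Ω)) : Submodule ℝ (Sq H) :=
  Submodule.span ℝ {r | ∃ x ∈ S, ∃ q, IsSaddlePoint x r q}

/-- `X ∈ V` solves the shape Newton equation `D²J(Ω)(X)(Y) = -DJ(Ω)(Y)` for all `Y ∈ V`. -/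
def SolvesNewton (J : Set Plane → ℝ) (V : Submodule ℝ (Sq H)) (X : Sq H) : Prop :=
  X ∈ V ∧ ∀ Y ∈ V, ∃ d : ℝ, HasBoundaryShapeDeriv J (field Y) d ∧
    HasBoundaryShapeDeriv₂ J (field X) (field Y) (-d)

/-- `Xν` is the Newton direction for `J(Ω) = ∫_Ω f dx`: the field on `∂Ω` given by a solution in
`[H(∂Ω)]²_ν` of the shape Newton equation, or, whether or not such a solution exists, the field
`-f / (∇f · ν + κ f) ν`. -/
def IsNewtonDirection (H : Type*) [NormedAddCommGroup H] [InnerProductSpace ℝ H]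
    [RKHS ℝ H (frontier Ω) ℝ] (f : Plane → ℝ) (Xν : frontier Ω → Plane) : Prop :=
  (∃ X : Sq H, SolvesNewton (shapeIntegral f) (normalFields H) X ∧ Xν = field X) ∨
    Xν = explicitDirection f Ω

end RKHS

end ShapeNewton

end

/-! Pulled back to `Ω`, both shape derivatives become integrals over a fixed set. For small t the
map id + tX is a C¹ diffeomorphism with positive Jacobian, and differentiation under the integral
gives DJ(X) = ∫_Ω div(fX). Applied to DJ at the domain (id + tY)(Ω), the same method gives D²J(X)(Y)
= ∫_Ω `secondVar f X Y`; the adjugate identity `tr_mul_det_of_comp_eq` removes the derivative of the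
inverse map.

For X of class C² the integrand `secondVar` is the divergence of `hessianField`, so the divergence
theorem moves it to the boundary; mollification in the C¹ norm extends the boundary formula to X of
class C¹. If X·τ = 0 along ∂Ω, then ∂_τX·τ = κ X·ν (`inner_fderiv_tangent`). Writing w = ∇f·ν + κf,
this gives for normal fields D²J(X)(Y) = ∫ w (X·ν)(Y·ν) and DJ(Y) = ∫ f Y·ν
(`setIntegral_secondVar`, `setIntegral_firstVar`).

The Newton equation on a space of normal fields therefore says that w X·ν + f is orthogonal to all
normal components in that space: X is the projection of -(f/w)ν in the L² product with weight w.
Claim 1 follows by testing with enough normal fields, claim 2 from positive definiteness in finite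
dimension, claim 3 from best approximation in the weighted norm, which is equivalent to L² because w
is continuous and positive on a compact set. The span `basisSpan` qualifies because saddle point
solutions are normal and unique.

The boundary integrals use a measure σ glued from graph charts (`exists_isBoundaryMeasure`), for
which the divergence theorem is Fubini below a graph. It need not be identified with arc length:
two-sided comparability costs only a constant depending on `Ω`. -/

noncomputable section

namespace ShapeNewton

/-! ### Linear maps of the plane -/

/-- The matrix entries of an endomorphism of the plane. -/
def entry (A : Plane →L[ℝ] Plane) (i j : Fin 2) : ℝ := A (EuclideanSpace.single j 1) i

/-- The trace of an endomorphism of the plane. -/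
def tr (A : Plane →L[ℝ] Plane) : ℝ := entry A 0 0 + entry A 1 1

/-- The polarised determinant `tr A tr B - tr (A B)`. -/
def mixedDet (A B : Plane →L[ℝ] Plane) : ℝ :=
  entry A 0 0 * entry B 1 1 + entry A 1 1 * entry B 0 0
    - entry A 0 1 * entry B 1 0 - entry A 1 0 * entry B 0 1

@[fun_prop]
lemma continuous_entry (i j : Fin 2) : Continuous fun A : Plane →L[ℝ] Plane => entry A i j := by
  unfold entry; fun_prop

@[fun_prop]
lemma continuous_tr : Continuous tr := by unfold tr; fun_prop

lemma plane_eq (v : Plane) :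
    v = v 0 • EuclideanSpace.single 0 (1 : ℝ) + v 1 • EuclideanSpace.single 1 (1 : ℝ) := by
  ext i; fin_cases i <;> simp

lemma apply_eq_entry (A : Plane →L[ℝ] Plane) (v : Plane) (i : Fin 2) :
    A v i = entry A i 0 * v 0 + entry A i 1 * v 1 := by
  conv_lhs => rw [plane_eq v]
  simp [entry, mul_comm]

@[simp] lemma entry_add (A B : Plane →L[ℝ] Plane) (i j : Fin 2) :
    entry (A + B) i j = entry A i j + entry B i j := rfl

@[simp] lemma entry_smul (c : ℝ) (A : Plane →L[ℝ] Plane) (i j : Fin 2) :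
    entry (c • A) i j = c * entry A i j := rfl

lemma entry_comp (A B : Plane →L[ℝ] Plane) (i j : Fin 2) :
    entry (A ∘L B) i j = entry A i 0 * entry B 0 j + entry A i 1 * entry B 1 j := by
  rw [entry, ContinuousLinearMap.comp_apply, apply_eq_entry]; rfl

@[simp] lemma entry_id (i j : Fin 2) :
    entry (ContinuousLinearMap.id ℝ Plane) i j = if i = j then 1 else 0 := by
  fin_cases i <;> fin_cases j <;> simp [entry]

lemma det_eq_entry (A : Plane →L[ℝ] Plane) :
    A.det = entry A 0 0 * entry A 1 1 - entry A 0 1 * entry A 1 0 := by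
  rw [ContinuousLinearMap.det,
    ← LinearMap.det_toMatrix (EuclideanSpace.basisFun (Fin 2) ℝ).toBasis, Matrix.det_fin_two]
  simp [LinearMap.toMatrix_apply, entry]

/-- The quadratic coefficient is det A, since `mixedDet` is the polarisation of 2 det. -/
lemma det_id_add_smul (A : Plane →L[ℝ] Plane) (t : ℝ) :
    (ContinuousLinearMap.id ℝ Plane + t • A).det = 1 + t * tr A + t ^ 2 * (mixedDet A A / 2) := by
  rw [det_eq_entry]
  simp [tr, mixedDet]
  ring

/-- In the plane the adjugate of 1 + tB is 1 + t(tr B - B), so tr C det(1 + tB) = tr(A adj(1 + tB))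
is affine in t. With C the derivative of X ∘ (id + tY)⁻¹, the divergence of the transported field
times the Jacobian then involves no inverse. -/
lemma tr_mul_det_of_comp_eq {A B C : Plane →L[ℝ] Plane} {t : ℝ}
    (h : C ∘L (ContinuousLinearMap.id ℝ Plane + t • B) = A) :
    tr C * (1 + t * tr B + t ^ 2 * (mixedDet B B / 2)) = tr A + t * mixedDet A B := by
  subst h
  simp only [tr, mixedDet, entry_comp, entry_add, entry_smul, entry_id]
  norm_num
  ring

/-! ### Differentiation under the integral sign -/

lemma integrableOn_of_continuous {E : Type*} [NormedAddCommGroup E] {Ω : Set Plane}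
    (hb : Bornology.IsBounded Ω) {u : Plane → E} (hu : Continuous u) : IntegrableOn u Ω := by
  have hc : IsCompact (closure Ω) := hb.isCompact_closure
  exact (hu.continuousOn.integrableOn_compact hc).mono_set subset_closure

/-- Joint continuity bounds G' on the compact set [-1, 1] × closure Ω, which supplies the dominating
constant. -/
lemma hasDerivAt_setIntegral {Ω : Set Plane} (hb : Bornology.IsBounded Ω)
    (hm : MeasurableSet Ω) {G G' : ℝ → Plane → ℝ}
    (hG : Continuous fun p : ℝ × Plane => G p.1 p.2)
    (hG' : Continuous fun p : ℝ × Plane => G' p.1 p.2)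
    (h : ∀ t x, HasDerivAt (fun s => G s x) (G' t x) t) :
    HasDerivAt (fun t => ∫ x in Ω, G t x) (∫ x in Ω, G' 0 x) 0 := by
  have hc : IsCompact (Icc (-1 : ℝ) 1 ×ˢ closure Ω) := isCompact_Icc.prod hb.isCompact_closure
  obtain ⟨C, hC⟩ := hc.exists_bound_of_continuousOn hG'.continuousOn
  have hGt (t) : Continuous (G t) := hG.comp (Continuous.prodMk_right t)
  have hGt' (t) : Continuous (G' t) := hG'.comp (Continuous.prodMk_right t)
  refine (hasDerivAt_integral_of_dominated_loc_of_deriv_le (s := Icc (-1) 1)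
    (bound := fun _ => C) (Icc_mem_nhds (by norm_num) (by norm_num))
    (Eventually.of_forall fun t => (hGt t).aestronglyMeasurable)
    (integrableOn_of_continuous hb (hGt 0)) (hGt' 0).aestronglyMeasurable ?_
    (integrableOn_of_continuous hb continuous_const) ?_).2
  · exact (ae_restrict_mem hm).mono fun x hx t ht => hC (t, x) ⟨ht, subset_closure hx⟩
  · exact Eventually.of_forall fun x t _ => h t x

/-! ### Perturbations of the identity -/

lemma exists_bound_fderiv {X : Plane → Plane} (hX : ContDiff ℝ 1 X) (hc : HasCompactSupport X) :
    ∃ M, ∀ x, |tr (fderiv ℝ X x)| ≤ M ∧ |mixedDet (fderiv ℝ X x) (fderiv ℝ X x) / 2| ≤ M := by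
  have hD : Continuous (fderiv ℝ X) := hX.continuous_fderiv one_ne_zero
  have hDc : HasCompactSupport (fderiv ℝ X) := hc.fderiv ℝ
  have h1 : Continuous fun x => tr (fderiv ℝ X x) := by fun_prop
  have h2 : Continuous fun x => mixedDet (fderiv ℝ X x) (fderiv ℝ X x) / 2 := by
    unfold mixedDet; fun_prop
  obtain ⟨M₁, hM₁⟩ := (hDc.comp_left (g := tr) (by simp [tr, entry])).exists_bound_of_continuous h1
  obtain ⟨M₂, hM₂⟩ := (hDc.comp_left (g := fun A => mixedDet A A / 2)
    (by simp [mixedDet, entry])).exists_bound_of_continuous h2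
  exact ⟨max M₁ M₂, fun x => ⟨(hM₁ x).trans (le_max_left _ _), (hM₂ x).trans (le_max_right _ _)⟩⟩

lemma hasFDerivAt_perturb {X : Plane → Plane} (hX : ContDiff ℝ 1 X) (t : ℝ) (x : Plane) :
    HasFDerivAt (perturb X t) (ContinuousLinearMap.id ℝ Plane + t • fderiv ℝ X x) x :=
  (hasFDerivAt_id x).add (((hX.differentiable one_ne_zero) x).hasFDerivAt.const_smul t)

/-- A compactly supported C¹ field is globally Lipschitz, so id + tX is a contraction away from the
identity once |t|K < 1, and its Jacobian is uniformly close to 1. -/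
lemma eventually_perturb {X : Plane → Plane} (hX : ContDiff ℝ 1 X) (hc : HasCompactSupport X) :
    ∀ᶠ t in 𝓝 (0 : ℝ), (∃ e : Plane ≃ₜ Plane, ⇑e = perturb X t) ∧
      ∀ x, 0 < (ContinuousLinearMap.id ℝ Plane + t • fderiv ℝ X x).det := by
  obtain ⟨K, hK⟩ := hX.lipschitzWith_of_hasCompactSupport hc one_ne_zero
  obtain ⟨M, hM⟩ := exists_bound_fderiv hX hc
  have e1 : ∀ᶠ t in 𝓝 (0 : ℝ), |t| * (K : ℝ) < 1 := by
    have : Tendsto (fun t : ℝ => |t| * (K : ℝ)) (𝓝 0) (𝓝 (|0| * (K : ℝ))) :=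
      (by fun_prop : Continuous fun t : ℝ => |t| * (K : ℝ)).tendsto 0
    exact this.eventually_lt_const (by simp)
  have e2 : ∀ᶠ t in 𝓝 (0 : ℝ), |t| * M + t ^ 2 * M < 1 := by
    have : Tendsto (fun t : ℝ => |t| * M + t ^ 2 * M) (𝓝 0) (𝓝 (|0| * M + 0 ^ 2 * M)) :=
      (by fun_prop : Continuous fun t : ℝ => |t| * M + t ^ 2 * M).tendsto 0
    exact this.eventually_lt_const (by simp)
  filter_upwards [e1, e2] with t h1 h2
  constructor
  · have happ : ApproximatesLinearOn (perturb X t)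
        ((ContinuousLinearEquiv.refl ℝ Plane : Plane ≃L[ℝ] Plane) : Plane →L[ℝ] Plane) univ
        (‖t‖₊ * K) := by
      intro x _ y _
      have : perturb X t x - perturb X t y
          - ((ContinuousLinearEquiv.refl ℝ Plane : Plane ≃L[ℝ] Plane) : Plane →L[ℝ] Plane) (x - y)
          = t • (X x - X y) := by
        simp only [perturb, ContinuousLinearEquiv.coe_refl, ContinuousLinearMap.id_apply, smul_sub]
        abel
      rw [this, norm_smul, NNReal.coe_mul, mul_assoc]
      exact mul_le_mul_of_nonneg_left (hK.norm_sub_le x y) (norm_nonneg _)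
    refine ⟨happ.toHomeomorph _ (Or.inr ?_), rfl⟩
    have hone : ‖(((ContinuousLinearEquiv.refl ℝ Plane).symm : Plane ≃L[ℝ] Plane) :
        Plane →L[ℝ] Plane)‖₊ = 1 := by
      have : ‖ContinuousLinearMap.id ℝ Plane‖ = 1 := ContinuousLinearMap.norm_id
      exact NNReal.eq this
    rw [hone, inv_one, ← NNReal.coe_lt_coe]
    simpa using h1
  · intro x
    rw [det_id_add_smul]
    have h3 : -(|t| * M) ≤ t * tr (fderiv ℝ X x) := by
      have : |t * tr (fderiv ℝ X x)| ≤ |t| * M := by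
        rw [abs_mul]; exact mul_le_mul_of_nonneg_left (hM x).1 (abs_nonneg t)
      exact (abs_le.1 this).1
    have h4 : -(t ^ 2 * M) ≤ t ^ 2 * (mixedDet (fderiv ℝ X x) (fderiv ℝ X x) / 2) := by
      have := mul_le_mul_of_nonneg_left (abs_le.1 (hM x).2).1 (sq_nonneg t)
      linarith
    linarith

/-- The range of t is chosen before `Ω` and `u`: later `u` is itself built from the inverse of id +
tY and so depends on t. -/
lemma eventually_setIntegral_perturb {X : Plane → Plane} (hX : ContDiff ℝ 1 X)
    (hc : HasCompactSupport X) :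
    ∀ᶠ t in 𝓝 (0 : ℝ), ∀ (Ω : Set Plane), MeasurableSet Ω → ∀ u : Plane → ℝ,
      ∫ x in perturb X t '' Ω, u x = ∫ x in Ω, u (perturb X t x) *
        (1 + t * tr (fderiv ℝ X x) + t ^ 2 * (mixedDet (fderiv ℝ X x) (fderiv ℝ X x) / 2)) := by
  filter_upwards [eventually_perturb hX hc] with t ht Ω hm u
  obtain ⟨⟨e, he⟩, hdet⟩ := ht
  rw [integral_image_eq_integral_abs_det_fderiv_smul volume hm
    (fun x _ => (hasFDerivAt_perturb hX t x).hasFDerivWithinAt)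
    (by rw [← he]; exact e.injective.injOn)]
  refine setIntegral_congr_fun hm fun x _ => ?_
  rw [abs_of_pos (hdet x), det_id_add_smul, smul_eq_mul, mul_comm]

/-! ### First and second shape derivatives of the integral -/

/-- The integrand `div (f X)` of the first shape derivative of `∫_Ω f`. -/
def firstVar (f : Plane → ℝ) (X : Plane → Plane) (x : Plane) : ℝ :=
  fderiv ℝ f x (X x) + f x * tr (fderiv ℝ X x)

/-- The integrand of the second shape derivative of `∫_Ω f`. -/
def secondVar (f : Plane → ℝ) (X Y : Plane → Plane) (x : Plane) : ℝ :=
  fderiv ℝ (fderiv ℝ f) x (Y x) (X x) + fderiv ℝ f x (X x) * tr (fderiv ℝ Y x)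
    + (fderiv ℝ f x (Y x) * tr (fderiv ℝ X x)
      + f x * mixedDet (fderiv ℝ X x) (fderiv ℝ Y x))

lemma hasDerivAt_quadratic (a b t : ℝ) :
    HasDerivAt (fun s : ℝ => 1 + s * a + s ^ 2 * b) (a + 2 * t * b) t := by
  have := (((hasDerivAt_id' t).mul_const a).const_add 1).fun_add ((hasDerivAt_pow 2 t).mul_const b)
  simpa using this

lemma tendsto_div_of_hasDerivAt {J : ℝ → ℝ} {d : ℝ} (h : HasDerivAt J d 0) :
    Tendsto (fun t => (J t - J 0) / t) (𝓝[>] 0) (𝓝 d) := by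
  have := h.tendsto_slope_zero_right
  simpa [div_eq_inv_mul] using this

lemma hasShapeDeriv_shapeIntegral {f : Plane → ℝ} (hf : ContDiff ℝ 2 f) {Ω : Set Plane}
    (hb : Bornology.IsBounded Ω) (hm : MeasurableSet Ω) {X : Plane → Plane}
    (hX : ContDiff ℝ 1 X) (hc : HasCompactSupport X) :
    HasShapeDeriv (shapeIntegral f) Ω X (∫ x in Ω, firstVar f X x) := by
  have hfc := hf.continuous
  have hXc := hX.continuous
  have hf' := hf.continuous_fderiv two_ne_zero
  have hX' := hX.continuous_fderiv one_ne_zero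
  let δ (t : ℝ) (x : Plane) : ℝ :=
    1 + t * tr (fderiv ℝ X x) + t ^ 2 * (mixedDet (fderiv ℝ X x) (fderiv ℝ X x) / 2)
  let δ' (t : ℝ) (x : Plane) : ℝ :=
    tr (fderiv ℝ X x) + 2 * t * (mixedDet (fderiv ℝ X x) (fderiv ℝ X x) / 2)
  have hp : Continuous fun p : ℝ × Plane => perturb X p.1 p.2 := by unfold perturb; fun_prop
  have hδ : Continuous fun p : ℝ × Plane => δ p.1 p.2 := by
    simp only [δ, mixedDet]; fun_prop
  have hδ' : Continuous fun p : ℝ × Plane => δ' p.1 p.2 := by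
    simp only [δ', mixedDet]; fun_prop
  have key := hasDerivAt_setIntegral hb hm
    (G := fun t x => f (perturb X t x) * δ t x)
    (G' := fun t x => fderiv ℝ f (perturb X t x) (X x) * δ t x + f (perturb X t x) * δ' t x)
    (by fun_prop) (by fun_prop) ?_
  · have h2 := tendsto_div_of_hasDerivAt key
    have h3 : (∫ x in Ω, fderiv ℝ f (perturb X 0 x) (X x) * δ 0 x + f (perturb X 0 x) * δ' 0 x)
        = ∫ x in Ω, firstVar f X x := by
      simp [perturb, δ, δ', firstVar]
    rw [h3] at h2
    refine h2.congr' ?_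
    have := (eventually_setIntegral_perturb hX hc).filter_mono
      (nhdsWithin_le_nhds (s := Ioi (0 : ℝ)))
    filter_upwards [this] with t ht
    rw [shapeIntegral, shapeIntegral, ht Ω hm f]
    simp [perturb, δ]
  · intro t x
    have d1 : HasDerivAt (fun s : ℝ => perturb X s x) (X x) t := by
      simpa [perturb] using ((hasDerivAt_id t).smul_const (X x)).const_add x
    have d2 : HasDerivAt (fun s : ℝ => f (perturb X s x)) (fderiv ℝ f (perturb X t x) (X x)) t :=
      ((hf.differentiable two_ne_zero) _).hasFDerivAt.comp_hasDerivAt t d1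
    have d3 : HasDerivAt (fun s : ℝ => δ s x) (δ' t x) t :=
      hasDerivAt_quadratic _ _ t
    exact d2.mul d3

lemma HasShapeDeriv.unique {J : Set Plane → ℝ} {Ω : Set Plane} {X : Plane → Plane} {d d' : ℝ}
    (h : HasShapeDeriv J Ω X d) (h' : HasShapeDeriv J Ω X d') : d = d' :=
  tendsto_nhds_unique h h'

/-- The first derivative formula on the moved domain, pulled back to `Ω`. The result depends on t
only through `perturb Y t` and polynomials in t, hence can be differentiated once more. -/
lemma eventually_hasShapeDeriv_perturb {f : Plane → ℝ} (hf : ContDiff ℝ 2 f) {Ω : Set Plane}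
    (hb : Bornology.IsBounded Ω) (ho : IsOpen Ω) {X Y : Plane → Plane}
    (hX : ContDiff ℝ 1 X) (hXc : HasCompactSupport X) (hY : ContDiff ℝ 1 Y)
    (hYc : HasCompactSupport Y) :
    ∀ᶠ t in 𝓝 (0 : ℝ), HasShapeDeriv (shapeIntegral f) (perturb Y t '' Ω)
      (X ∘ Function.invFun (perturb Y t))
      (∫ x in Ω, (fderiv ℝ f (perturb Y t x) (X x) *
          (1 + t * tr (fderiv ℝ Y x) + t ^ 2 * (mixedDet (fderiv ℝ Y x) (fderiv ℝ Y x) / 2))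
        + f (perturb Y t x) *
          (tr (fderiv ℝ X x) + t * mixedDet (fderiv ℝ X x) (fderiv ℝ Y x)))) := by
  filter_upwards [eventually_perturb hY hYc, eventually_setIntegral_perturb hY hYc] with t h1 h2
  obtain ⟨⟨e, he⟩, hdet⟩ := h1
  have hinv : Function.invFun (perturb Y t) = e.symm := by
    rw [← he]
    funext x
    apply e.injective
    rw [Function.invFun_eq ⟨e.symm x, e.apply_symm_apply x⟩, e.apply_symm_apply]
  -- The transported field must again be C¹ for the first derivative formula; the nonvanishing
  -- Jacobian makes the inverse C¹.
  have hsymm : ContDiff ℝ 1 e.symm := by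
    refine e.contDiff_symm (f₀' := fun x =>
      ContinuousLinearMap.toContinuousLinearEquivOfDetNeZero _ (hdet x).ne') (fun x => ?_) ?_
    · rw [ContinuousLinearMap.coe_toContinuousLinearEquivOfDetNeZero, he]
      exact hasFDerivAt_perturb hY t x
    · rw [he]; unfold perturb; fun_prop
  have hZ : ContDiff ℝ 1 (X ∘ e.symm) := hX.comp hsymm
  have hZc : HasCompactSupport (X ∘ e.symm) := hXc.comp_homeomorph e.symm
  have hopen : IsOpen (perturb Y t '' Ω) := by rw [← he]; exact e.isOpenMap _ ho
  have hbdd : Bornology.IsBounded (perturb Y t '' Ω) := by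
    rw [← he]
    exact (hb.isCompact_closure.image e.continuous).isBounded.subset (image_mono subset_closure)
  have h3 := hasShapeDeriv_shapeIntegral hf hbdd hopen.measurableSet hZ hZc
  rw [hinv]
  convert h3 using 1
  rw [h2 Ω ho.measurableSet]
  refine setIntegral_congr_fun ho.measurableSet fun x _ => ?_
  have hcomp : fderiv ℝ (X ∘ e.symm) (perturb Y t x) ∘L
      (ContinuousLinearMap.id ℝ Plane + t • fderiv ℝ Y x) = fderiv ℝ X x := by
    have e1 : (X ∘ e.symm) ∘ perturb Y t = X := by
      funext y; simp [← he]
    have e2 := (((hZ.differentiable one_ne_zero) (perturb Y t x)).hasFDerivAt.comp x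
      (hasFDerivAt_perturb hY t x)).fderiv
    rw [e1] at e2
    exact e2.symm
  have e3 : (X ∘ e.symm) (perturb Y t x) = X x := by simp [← he]
  simp only [firstVar, e3, ← tr_mul_det_of_comp_eq hcomp]
  ring

lemma hasShapeDeriv₂_shapeIntegral {f : Plane → ℝ} (hf : ContDiff ℝ 2 f) {Ω : Set Plane}
    (hb : Bornology.IsBounded Ω) (ho : IsOpen Ω) {X Y : Plane → Plane}
    (hX : ContDiff ℝ 1 X) (hXc : HasCompactSupport X) (hY : ContDiff ℝ 1 Y)
    (hYc : HasCompactSupport Y) :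
    HasShapeDeriv₂ (shapeIntegral f) Ω X Y (∫ x in Ω, secondVar f X Y x) := by
  refine ⟨_, _, hasShapeDeriv_shapeIntegral hf hb ho.measurableSet hX hXc,
    (eventually_hasShapeDeriv_perturb hf hb ho hX hXc hY hYc).filter_mono nhdsWithin_le_nhds, ?_⟩
  have hfc := hf.continuous
  have hXc := hX.continuous
  have hYc := hY.continuous
  have hf1 : ContDiff ℝ 1 (fderiv ℝ f) := hf.fderiv_right (by norm_num)
  have hf' := hf1.continuous
  have hf'' := hf1.continuous_fderiv one_ne_zero
  have hX' := hX.continuous_fderiv one_ne_zero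
  have hY' := hY.continuous_fderiv one_ne_zero
  let δ (t : ℝ) (x : Plane) : ℝ :=
    1 + t * tr (fderiv ℝ Y x) + t ^ 2 * (mixedDet (fderiv ℝ Y x) (fderiv ℝ Y x) / 2)
  let δ' (t : ℝ) (x : Plane) : ℝ :=
    tr (fderiv ℝ Y x) + 2 * t * (mixedDet (fderiv ℝ Y x) (fderiv ℝ Y x) / 2)
  let θ (t : ℝ) (x : Plane) : ℝ := tr (fderiv ℝ X x) + t * mixedDet (fderiv ℝ X x) (fderiv ℝ Y x)
  have hp : Continuous fun p : ℝ × Plane => perturb Y p.1 p.2 := by unfold perturb; fun_prop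
  have hδ : Continuous fun p : ℝ × Plane => δ p.1 p.2 := by
    simp only [δ, mixedDet]; fun_prop
  have hδ' : Continuous fun p : ℝ × Plane => δ' p.1 p.2 := by
    simp only [δ', mixedDet]; fun_prop
  have hθ : Continuous fun p : ℝ × Plane => θ p.1 p.2 := by
    simp only [θ, mixedDet]; fun_prop
  have hm : Continuous fun p : ℝ × Plane => mixedDet (fderiv ℝ X p.2) (fderiv ℝ Y p.2) := by
    unfold mixedDet; fun_prop
  have key := hasDerivAt_setIntegral hb ho.measurableSet
    (G := fun t x => fderiv ℝ f (perturb Y t x) (X x) * δ t x + f (perturb Y t x) * θ t x)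
    (G' := fun t x => (fderiv ℝ (fderiv ℝ f) (perturb Y t x) (Y x) (X x) * δ t x
      + fderiv ℝ f (perturb Y t x) (X x) * δ' t x) + (fderiv ℝ f (perturb Y t x) (Y x) * θ t x
      + f (perturb Y t x) * mixedDet (fderiv ℝ X x) (fderiv ℝ Y x)))
    (by fun_prop) (by fun_prop) ?_
  · have h2 := tendsto_div_of_hasDerivAt key
    convert h2 using 2
    · simp [perturb, δ, θ, firstVar]
    · simp [perturb, δ, δ', θ, secondVar]
  · intro t x
    have d1 : HasDerivAt (fun s : ℝ => perturb Y s x) (Y x) t := by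
      simpa [perturb] using ((hasDerivAt_id t).smul_const (Y x)).const_add x
    have d2 : HasDerivAt (fun s : ℝ => f (perturb Y s x)) (fderiv ℝ f (perturb Y t x) (Y x)) t :=
      ((hf.differentiable two_ne_zero) _).hasFDerivAt.comp_hasDerivAt t d1
    have d2' : HasDerivAt (fun s : ℝ => fderiv ℝ f (perturb Y s x) (X x))
        (fderiv ℝ (fderiv ℝ f) (perturb Y t x) (Y x) (X x)) t := by
      have := ((hf1.differentiable one_ne_zero) _).hasFDerivAt.comp_hasDerivAt t d1
      simpa using HasDerivAt.clm_apply this (hasDerivAt_const t (X x))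
    have d3 : HasDerivAt (fun s : ℝ => δ s x) (δ' t x) t :=
      hasDerivAt_quadratic _ _ t
    have d4 : HasDerivAt (fun s : ℝ => θ s x) (mixedDet (fderiv ℝ X x) (fderiv ℝ Y x)) t := by
      simpa [θ] using ((hasDerivAt_id t).mul_const
        (mixedDet (fderiv ℝ X x) (fderiv ℝ Y x))).const_add (tr (fderiv ℝ X x))
    exact (d2'.mul d3).add (d2.mul d4)

/-- The intermediate first derivatives d(t) are limits, so any two choices agree for small t > 0. -/
lemma HasShapeDeriv₂.unique {J : Set Plane → ℝ} {Ω : Set Plane} {X Y : Plane → Plane} {l l' : ℝ}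
    (h : HasShapeDeriv₂ J Ω X Y l) (h' : HasShapeDeriv₂ J Ω X Y l') : l = l' := by
  obtain ⟨d₀, d, h0, h1, h2⟩ := h
  obtain ⟨d₀', d', h0', h1', h2'⟩ := h'
  refine tendsto_nhds_unique h2 (h2'.congr' ?_)
  filter_upwards [h1, h1'] with t ht ht'
  rw [ht.unique ht', h0.unique h0']

/-! ### The rotation and orthonormal frames -/

lemma inner_plane (v w : Plane) : ⟪v, w⟫ = v 0 * w 0 + v 1 * w 1 := by
  simp [PiLp.inner_apply, Fin.sum_univ_two, mul_comm]

@[simp] lemma rot_apply_zero (v : Plane) : rot v 0 = -v 1 := rfl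

@[simp] lemma rot_apply_one (v : Plane) : rot v 1 = v 0 := rfl

/-- The rotation by a right angle as a continuous linear map. -/
def rotCLM : Plane →L[ℝ] Plane :=
  LinearMap.toContinuousLinearMap
    { toFun := rot
      map_add' := fun v w => by ext i; fin_cases i <;> simp [add_comm]
      map_smul' := fun c v => by ext i; fin_cases i <;> simp }

@[fun_prop]
lemma contDiff_rot {n : WithTop ℕ∞} : ContDiff ℝ n rot := rotCLM.contDiff

@[fun_prop]
lemma continuous_rot : Continuous rot := rotCLM.continuous

@[simp] lemma rot_rot (v : Plane) : rot (rot v) = -v := by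
  ext i; fin_cases i <;> simp

lemma rot_smul (c : ℝ) (v : Plane) : rot (c • v) = c • rot v := rotCLM.map_smul c v

lemma rot_sub (v w : Plane) : rot (v - w) = rot v - rot w := rotCLM.map_sub v w

@[simp] lemma inner_rot_rot (v w : Plane) : ⟪rot v, rot w⟫ = ⟪v, w⟫ := by
  simp [inner_plane, add_comm]

@[simp] lemma inner_self_rot (v : Plane) : ⟪v, rot v⟫ = 0 := by
  simp [inner_plane, mul_comm]

@[simp] lemma inner_rot_self (v : Plane) : ⟪rot v, v⟫ = 0 := by
  rw [real_inner_comm, inner_self_rot]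

lemma inner_rot_right (v w : Plane) : ⟪v, rot w⟫ = -⟪rot v, w⟫ := by
  simp [inner_plane]

lemma sq_add_sq_of_norm_one {e : Plane} (he : ‖e‖ = 1) : e 0 * e 0 + e 1 * e 1 = 1 := by
  rw [← inner_plane, real_inner_self_eq_norm_sq, he, one_pow]

lemma norm_rot (v : Plane) : ‖rot v‖ = ‖v‖ := by
  rw [@norm_eq_sqrt_real_inner Plane, @norm_eq_sqrt_real_inner Plane, inner_rot_rot]

lemma eq_inner_rot_add_inner {e : Plane} (he : ‖e‖ = 1) (x : Plane) :
    x = ⟪x, rot e⟫ • rot e + ⟪x, e⟫ • e := by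
  have h := sq_add_sq_of_norm_one he
  ext i
  fin_cases i
  · simp [inner_plane]; linear_combination -(x 0) * h
  · simp [inner_plane]; linear_combination -(x 1) * h

lemma inner_eq_zero_of_tangent {n v : Plane} (hn : ‖n‖ = 1) (h : ⟪v, rot n⟫ = 0) :
    v = ⟪v, n⟫ • n := by
  conv_lhs => rw [eq_inner_rot_add_inner hn v, h, zero_smul, zero_add]

/-! ### Local graphs -/

/-- The upward normal of the graph of `g` at `s`. -/
def graphNormal (e : Plane) (g : ℝ → ℝ) (s : ℝ) : Plane := e - deriv g s • rot e

/-- The upward unit normal of the graph of `g` at `s`. -/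
def unitGraphNormal (e : Plane) (g : ℝ → ℝ) (s : ℝ) : Plane :=
  ‖graphNormal e g s‖⁻¹ • graphNormal e g s

/-- The parametrisation of the graph of `g`. -/
def graphCurve (e : Plane) (g : ℝ → ℝ) (s : ℝ) : Plane := s • rot e + g s • e

lemma norm_graphNormal_sq {e : Plane} (he : ‖e‖ = 1) (g : ℝ → ℝ) (s : ℝ) :
    ‖graphNormal e g s‖ ^ 2 = 1 + deriv g s ^ 2 := by
  have h := sq_add_sq_of_norm_one he
  rw [← real_inner_self_eq_norm_sq, inner_plane]
  simp [graphNormal]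
  linear_combination (1 + deriv g s ^ 2) * h

lemma one_le_norm_graphNormal {e : Plane} (he : ‖e‖ = 1) (g : ℝ → ℝ) (s : ℝ) :
    1 ≤ ‖graphNormal e g s‖ := by
  have h := norm_graphNormal_sq he g s
  nlinarith [norm_nonneg (graphNormal e g s), sq_nonneg (deriv g s)]

lemma norm_unitGraphNormal {e : Plane} (he : ‖e‖ = 1) (g : ℝ → ℝ) (s : ℝ) :
    ‖unitGraphNormal e g s‖ = 1 := by
  have h := one_le_norm_graphNormal he g s
  rw [unitGraphNormal, norm_smul, norm_inv, norm_norm, inv_mul_cancel₀ (by linarith)]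

lemma contDiff_unitGraphNormal {e : Plane} (he : ‖e‖ = 1) {g : ℝ → ℝ} {k : ℕ}
    (hg : ContDiff ℝ (k + 1 : ℕ) g) : ContDiff ℝ k (unitGraphNormal e g) := by
  have h1 : ContDiff ℝ k (deriv g) := by
    have : ContDiff ℝ ((k : WithTop ℕ∞) + 1) g := by exact_mod_cast hg
    exact (contDiff_succ_iff_deriv.1 this).2.2
  have h2 : ContDiff ℝ k (graphNormal e g) := contDiff_const.sub (h1.smul contDiff_const)
  have h3 (s) : graphNormal e g s ≠ 0 := by
    have := one_le_norm_graphNormal he g s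
    exact norm_pos_iff.1 (by linarith)
  exact ((h2.norm ℝ h3).inv fun s => norm_ne_zero_iff.2 (h3 s)).smul h2

lemma rot_graphNormal (e : Plane) (g : ℝ → ℝ) (s : ℝ) :
    rot (graphNormal e g s) = rot e + deriv g s • e := by
  rw [graphNormal, rot_sub, rot_smul, rot_rot, smul_neg, sub_neg_eq_add]

lemma hasDerivAt_graphCurve (e : Plane) {g : ℝ → ℝ} (hg : ContDiff ℝ 1 g) (s : ℝ) :
    HasDerivAt (graphCurve e g) (rot (graphNormal e g s)) s := by
  rw [rot_graphNormal]
  have h1 := (hasDerivAt_id' s).smul_const (rot e)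
  have h2 := ((hg.differentiable one_ne_zero) s).hasDerivAt.smul_const e
  rw [one_smul] at h1
  exact h1.fun_add h2

@[simp] lemma inner_graphCurve_rot {e : Plane} (he : ‖e‖ = 1) (g : ℝ → ℝ) (s : ℝ) :
    ⟪graphCurve e g s, rot e⟫ = s := by
  rw [graphCurve, inner_add_left, inner_smul_left, inner_smul_left, inner_rot_rot, inner_self_rot,
    real_inner_self_eq_norm_sq, he]
  simp

@[simp] lemma inner_graphCurve {e : Plane} (he : ‖e‖ = 1) (g : ℝ → ℝ) (s : ℝ) :
    ⟪graphCurve e g s, e⟫ = g s := by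
  rw [graphCurve, inner_add_left, inner_smul_left, inner_smul_left, inner_rot_self,
    real_inner_self_eq_norm_sq, he]
  simp

namespace IsLocalGraph

variable {m : ℕ} {Ω : Set Plane} {p e : Plane} {g : ℝ → ℝ} {r : ℝ}

lemma recenter (h : IsLocalGraph m Ω p e g r) {q : Plane} (hq : q ∈ Metric.ball p r) :
    IsLocalGraph m Ω q e g (r - dist q p) where
  unit := h.unit
  pos := by rw [Metric.mem_ball] at hq; linarith
  smooth := h.smooth
  below x hx := h.below x <| by
    rw [Metric.mem_ball] at hx ⊢
    linarith [dist_triangle x q p]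

lemma of_le (h : IsLocalGraph m Ω p e g r) {m' : ℕ} (hm : m' ≤ m) : IsLocalGraph m' Ω p e g r :=
  { h with smooth := h.smooth.of_le (by exact_mod_cast hm) }

/-- A point strictly above the graph has a neighbourhood disjoint from `Ω`; a point on the graph is
the limit of x - te, which lies below it. -/
lemma mem_frontier_iff (h : IsLocalGraph m Ω p e g r) (ho : IsOpen Ω) {x : Plane}
    (hx : x ∈ Metric.ball p r) : x ∈ frontier Ω ↔ ⟪x, e⟫ = g ⟪x, rot e⟫ := by
  have hgc : Continuous g := h.smooth.continuous
  have hball : Metric.ball p r ∈ 𝓝 x := Metric.isOpen_ball.mem_nhds hx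
  rw [ho.frontier_eq, Set.mem_sdiff, h.below x hx, not_lt]
  constructor
  · rintro ⟨hcl, hle⟩
    refine le_antisymm (not_lt.1 fun hlt => ?_) hle
    have hop : ∀ᶠ y in 𝓝 x, g ⟪y, rot e⟫ < ⟪y, e⟫ :=
      (by fun_prop : Continuous fun y : Plane => g ⟪y, rot e⟫).continuousAt.eventually_lt
        (by fun_prop : Continuous fun y : Plane => ⟪y, e⟫).continuousAt hlt
    obtain ⟨y, ⟨hy1, hy2⟩, hy3⟩ := mem_closure_iff_nhds.1 hcl _ (hop.and hball)
    exact lt_asymm hy1 ((h.below y hy2).1 hy3)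
  · intro heq
    refine ⟨?_, heq.ge⟩
    have hc : Continuous fun t : ℝ => x - t • e := by fun_prop
    have ht : Tendsto (fun t : ℝ => x - t • e) (𝓝[>] 0) (𝓝 x) :=
      (by simpa using hc.tendsto 0 : Tendsto (fun t : ℝ => x - t • e) (𝓝 0) (𝓝 x)).mono_left
        nhdsWithin_le_nhds
    refine mem_closure_of_tendsto ht ?_
    filter_upwards [ht hball, self_mem_nhdsWithin] with t htb htp
    rw [h.below _ htb, inner_sub_left, inner_sub_left, inner_smul_left, inner_smul_left,
      inner_self_rot, real_inner_self_eq_norm_sq, h.unit, heq]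
    simpa using htp

lemma graphCurve_inner (h : IsLocalGraph m Ω p e g r) (ho : IsOpen Ω) {x : Plane}
    (hx : x ∈ Metric.ball p r) (hxf : x ∈ frontier Ω) : graphCurve e g ⟪x, rot e⟫ = x := by
  rw [graphCurve, ← (h.mem_frontier_iff ho hx).1 hxf, ← eq_inner_rot_add_inner h.unit]

lemma graphCurve_mem_frontier (h : IsLocalGraph m Ω p e g r) (ho : IsOpen Ω) {s : ℝ}
    (hs : graphCurve e g s ∈ Metric.ball p r) : graphCurve e g s ∈ frontier Ω := by
  rw [h.mem_frontier_iff ho hs, inner_graphCurve h.unit, inner_graphCurve_rot h.unit]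

lemma hasDerivAt_height (h : IsLocalGraph 1 Ω p e g r) (v : Plane) :
    HasDerivAt (fun t : ℝ => ⟪p + t • v, e⟫ - g ⟪p + t • v, rot e⟫)
      ⟪graphNormal e g ⟪p, rot e⟫, v⟫ 0 := by
  have h1 (w : Plane) : HasDerivAt (fun t : ℝ => ⟪p + t • v, w⟫) ⟪v, w⟫ 0 := by
    have := ((hasDerivAt_id' (0 : ℝ)).mul_const ⟪v, w⟫).const_add ⟪p, w⟫
    simpa [inner_add_left, inner_smul_left] using this
  have h2 : HasDerivAt g (deriv g ⟪p, rot e⟫) ⟪p + (0 : ℝ) • v, rot e⟫ := by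
    simpa using ((h.smooth.differentiable (by simp)) ⟪p, rot e⟫).hasDerivAt
  have h3 := (h1 e).sub (h2.comp 0 (h1 (rot e)))
  refine h3.congr_deriv ?_
  rw [graphNormal, inner_sub_left, inner_smul_left, real_inner_comm v e, real_inner_comm v (rot e)]
  simp

end IsLocalGraph

lemma eventually_neg_of_hasDerivAt {F : ℝ → ℝ} {d : ℝ} (h : HasDerivAt F d 0) (h0 : F 0 = 0)
    (hd : d < 0) : ∀ᶠ t in 𝓝[>] (0 : ℝ), F t < 0 := by
  filter_upwards [(tendsto_div_of_hasDerivAt h).eventually_lt_const hd, self_mem_nhdsWithin]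
    with t ht htp
  rw [h0, sub_zero] at ht
  by_contra! hF
  exact absurd (div_nonneg hF (le_of_lt htp)) (not_le.2 ht)

lemma nonpos_of_hasDerivAt {F : ℝ → ℝ} {d : ℝ} (h : HasDerivAt F d 0) (h0 : F 0 = 0)
    (hF : ∀ᶠ t in 𝓝[>] (0 : ℝ), F t ≤ 0) : d ≤ 0 := by
  refine le_of_tendsto (tendsto_div_of_hasDerivAt h) ?_
  filter_upwards [hF, self_mem_nhdsWithin] with t ht htp
  rw [h0, sub_zero]
  exact div_nonpos_of_nonpos_of_nonneg ht (le_of_lt htp)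

/-! ### The normal field, tangential derivatives and curvature. -/

section Normal

variable {m : ℕ} {Ω : Set Plane} {p e : Plane} {g : ℝ → ℝ} {r : ℝ}

lemma IsLocalGraph.height_eq_zero (h : IsLocalGraph m Ω p e g r) (ho : IsOpen Ω)
    (hp : p ∈ frontier Ω) : ⟪p + (0 : ℝ) • (0 : Plane), e⟫ - g ⟪p, rot e⟫ = 0 := by
  rw [smul_zero, add_zero, (h.mem_frontier_iff ho (Metric.mem_ball_self h.pos)).1 hp, sub_self]

/-- A direction v with ⟪n, v⟫ < 0 enters `Ω`, which forces ⟪n', v⟫ ≤ 0 for any other chart normal.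
For distinct unit vectors v = n' - n violates this. Hence `normal`, defined by choice, can be
computed in any chart. -/
lemma IsOuterUnitNormal.unique (ho : IsOpen Ω) (hp : p ∈ frontier Ω) {n n' : Plane}
    (hn : IsOuterUnitNormal Ω p n) (hn' : IsOuterUnitNormal Ω p n') : n = n' := by
  obtain ⟨e, g, r, h, rfl⟩ := hn
  obtain ⟨e', g', r', h', rfl⟩ := hn'
  change unitGraphNormal e g _ = unitGraphNormal e' g' _
  set s := ⟪p, rot e⟫ with hs
  set s' := ⟪p, rot e'⟫ with hs'
  have key (v : Plane) (hv : ⟪graphNormal e g s, v⟫ < 0) : ⟪graphNormal e' g' s', v⟫ ≤ 0 := by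
    have ht : Tendsto (fun t : ℝ => p + t • v) (𝓝[>] 0) (𝓝 p) := by
      have hc : Continuous fun t : ℝ => p + t • v := by fun_prop
      exact (by simpa using hc.tendsto 0 :
        Tendsto (fun t : ℝ => p + t • v) (𝓝 0) (𝓝 p)).mono_left nhdsWithin_le_nhds
    have z := h.height_eq_zero ho hp
    have z' := h'.height_eq_zero ho hp
    refine nonpos_of_hasDerivAt (h'.hasDerivAt_height v) (by simpa using z') ?_
    filter_upwards [eventually_neg_of_hasDerivAt (h.hasDerivAt_height v) (by simpa using z) hv,
      ht (Metric.ball_mem_nhds p h.pos), ht (Metric.ball_mem_nhds p h'.pos)] with t h1 h2 h3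
    have := (h'.below _ h3).1 ((h.below _ h2).2 (by linarith))
    linarith
  have hu := norm_unitGraphNormal h.unit g s
  have hu' := norm_unitGraphNormal h'.unit g' s'
  by_contra hne
  have hlt : ⟪unitGraphNormal e g s, unitGraphNormal e' g' s'⟫ < 1 :=
    (inner_lt_one_iff_real_of_norm_eq_one hu hu').2 hne
  set v := unitGraphNormal e' g' s' - unitGraphNormal e g s with hvdef
  have a1 : ⟪unitGraphNormal e g s, v⟫ < 0 := by
    rw [hvdef, inner_sub_right, real_inner_self_eq_norm_sq, hu]; linarith
  have a2 : 0 < ⟪unitGraphNormal e' g' s', v⟫ := by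
    rw [hvdef, inner_sub_right, real_inner_self_eq_norm_sq, hu', real_inner_comm]; linarith
  rw [unitGraphNormal, inner_smul_left] at a1 a2
  have b1 : ⟪graphNormal e g s, v⟫ < 0 := by
    by_contra! hcon
    exact absurd (mul_nonneg (inv_nonneg.2 (norm_nonneg (graphNormal e g s))) hcon) (not_le.2 a1)
  have b2 := key v b1
  exact absurd (mul_nonpos_of_nonneg_of_nonpos
    (inv_nonneg.2 (norm_nonneg (graphNormal e' g' s'))) b2) (not_le.2 a2)

lemma IsLocalGraph.normal_eq (h : IsLocalGraph m Ω p e g r) (hm : 1 ≤ m) (ho : IsOpen Ω)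
    {q : Plane} (hq : q ∈ Metric.ball p r) (hqf : q ∈ frontier Ω) :
    normal Ω q = unitGraphNormal e g ⟪q, rot e⟫ := by
  have hn : IsOuterUnitNormal Ω q (unitGraphNormal e g ⟪q, rot e⟫) :=
    ⟨e, g, _, (h.recenter hq).of_le hm, rfl⟩
  have hex : ∃ n, IsOuterUnitNormal Ω q n := ⟨_, hn⟩
  rw [normal, dif_pos hex]
  exact hex.choose_spec.unique ho hqf hn

lemma HasCmBoundary.of_le (h : HasCmBoundary m Ω) {m' : ℕ} (hm : m' ≤ m) : HasCmBoundary m' Ω :=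
  fun p hp => let ⟨e, g, r, hg⟩ := h p hp; ⟨e, g, r, hg.of_le hm⟩

/-- The chart formula loses one derivative and extends the normal off the boundary by making it
constant in the direction e. -/
lemma exists_contDiff_normal {k : ℕ} (hΩ : HasCmBoundary (k + 1) Ω) (ho : IsOpen Ω)
    (hp : p ∈ frontier Ω) :
    ∃ Φ : Plane → Plane, ContDiff ℝ k Φ ∧ ∀ᶠ x in 𝓝[frontier Ω] p, normal Ω x = Φ x := by
  obtain ⟨e, g, r, h⟩ := hΩ p hp
  refine ⟨fun x => unitGraphNormal e g ⟪x, rot e⟫,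
    (contDiff_unitGraphNormal h.unit h.smooth).comp (contDiff_id.inner ℝ contDiff_const), ?_⟩
  filter_upwards [self_mem_nhdsWithin,
    mem_nhdsWithin_of_mem_nhds (Metric.ball_mem_nhds p h.pos)] with x hx hxb
  exact h.normal_eq (by omega) ho hxb hx

lemma norm_normal (hΩ : HasCmBoundary 1 Ω) (ho : IsOpen Ω) (hp : p ∈ frontier Ω) :
    ‖normal Ω p‖ = 1 := by
  obtain ⟨e, g, r, h⟩ := hΩ p hp
  rw [h.normal_eq le_rfl ho (Metric.mem_ball_self h.pos) hp, norm_unitGraphNormal h.unit]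

lemma continuousOn_normal (hΩ : HasCmBoundary 1 Ω) (ho : IsOpen Ω) :
    ContinuousOn (normal Ω) (frontier Ω) := by
  intro p hp
  obtain ⟨Φ, hΦ, heq⟩ := exists_contDiff_normal (k := 0) hΩ ho hp
  exact hΦ.continuous.continuousWithinAt.congr_of_eventuallyEq heq (heq.self_of_nhdsWithin hp)

lemma continuousOn_tangent (hΩ : HasCmBoundary 1 Ω) (ho : IsOpen Ω) :
    ContinuousOn (tangent Ω) (frontier Ω) :=
  continuous_rot.comp_continuousOn (continuousOn_normal hΩ ho)

/-- Boundary points lie on differentiable curves in the boundary with nonzero tangential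
velocity. -/
lemma exists_curve (hΩ : HasCmBoundary 1 Ω) (ho : IsOpen Ω) (hp : p ∈ frontier Ω) :
    ∃ (γ : ℝ → Plane) (s c : ℝ), c ≠ 0 ∧ γ s = p ∧ HasDerivAt γ (c • tangent Ω p) s ∧
      ∀ᶠ t in 𝓝 s, γ t ∈ frontier Ω := by
  obtain ⟨e, g, r, h⟩ := hΩ p hp
  have hpb := Metric.mem_ball_self (x := p) h.pos
  have hg1 : ContDiff ℝ 1 g := by exact_mod_cast h.smooth
  have hγ := hasDerivAt_graphCurve e hg1 ⟪p, rot e⟫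
  have hγp := h.graphCurve_inner ho hpb hp
  have hN := one_le_norm_graphNormal h.unit g ⟪p, rot e⟫
  refine ⟨graphCurve e g, ⟪p, rot e⟫, ‖graphNormal e g ⟪p, rot e⟫‖, by linarith, hγp, ?_, ?_⟩
  · rwa [tangent, h.normal_eq le_rfl ho hpb hp, unitGraphNormal, rot_smul,
      smul_inv_smul₀ (by linarith)]
  · have : ∀ᶠ t in 𝓝 ⟪p, rot e⟫, graphCurve e g t ∈ Metric.ball p r :=
      hγ.continuousAt.eventually (by rw [hγp]; exact Metric.ball_mem_nhds p h.pos)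
    exact this.mono fun t ht => h.graphCurve_mem_frontier ho ht

variable {E : Type*} [NormedAddCommGroup E] [NormedSpace ℝ E]

/-- A derivative within a curve is arbitrary in the normal direction. Composing with a boundary
curve sees only its tangential part, which is shared by all functions agreeing on the boundary. -/
lemma fderivWithin_tangent_eq (hΩ : HasCmBoundary 1 Ω) (ho : IsOpen Ω) (hp : p ∈ frontier Ω)
    {u Φ : Plane → E} (hΦ : DifferentiableAt ℝ Φ p) (heq : ∀ᶠ x in 𝓝[frontier Ω] p, u x = Φ x) :
    fderivWithin ℝ u (frontier Ω) p (tangent Ω p) = fderiv ℝ Φ p (tangent Ω p) := by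
  obtain ⟨γ, s, c, hc, rfl, hγ, hmem⟩ := exists_curve hΩ ho hp
  have hu : HasFDerivWithinAt u (fderivWithin ℝ u (frontier Ω) (γ s)) (frontier Ω) (γ s) :=
    (hΦ.differentiableWithinAt.congr_of_eventuallyEq heq
      (heq.self_of_nhdsWithin hp)).hasFDerivWithinAt
  have hγF : Tendsto γ (𝓝 s) (𝓝[frontier Ω] (γ s)) :=
    tendsto_nhdsWithin_iff.2 ⟨hγ.continuousAt, hmem⟩
  obtain ⟨T, hT, hTo, hsT⟩ := eventually_nhds_iff.1 hmem
  have h1 : HasDerivAt (u ∘ γ) (fderivWithin ℝ u (frontier Ω) (γ s) (c • tangent Ω (γ s))) s :=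
    (hu.comp_hasDerivWithinAt s (hγ.hasDerivWithinAt (s := T)) hT).hasDerivAt (hTo.mem_nhds hsT)
  have h2 : HasDerivAt (Φ ∘ γ) (fderiv ℝ Φ (γ s) (c • tangent Ω (γ s))) s :=
    hΦ.hasFDerivAt.comp_hasDerivAt s hγ
  have h3 := (h1.congr_of_eventuallyEq
    (f₁ := Φ ∘ γ) ((hγF.eventually heq).mono fun t ht => ht.symm)).unique h2
  rw [map_smul, map_smul] at h3
  exact smul_right_injective E hc h3

lemma fderiv_tangent_congr (hΩ : HasCmBoundary 1 Ω) (ho : IsOpen Ω) (hp : p ∈ frontier Ω)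
    {u Φ : Plane → E} (hu : DifferentiableAt ℝ u p) (hΦ : DifferentiableAt ℝ Φ p)
    (heq : ∀ᶠ x in 𝓝[frontier Ω] p, u x = Φ x) :
    fderiv ℝ u p (tangent Ω p) = fderiv ℝ Φ p (tangent Ω p) := by
  rw [← fderivWithin_tangent_eq hΩ ho hp hΦ heq,
    fderivWithin_tangent_eq hΩ ho hp hu (Eventually.of_forall fun _ => rfl)]

lemma curvature_eq (hΩ : HasCmBoundary 1 Ω) (ho : IsOpen Ω) (hp : p ∈ frontier Ω)
    {Φ : Plane → Plane} (hΦ : DifferentiableAt ℝ Φ p)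
    (heq : ∀ᶠ x in 𝓝[frontier Ω] p, normal Ω x = Φ x) :
    curvature Ω p = ⟪fderiv ℝ Φ p (tangent Ω p), tangent Ω p⟫ := by
  rw [curvature, fderivWithin_tangent_eq hΩ ho hp hΦ heq]

/-- One local C¹ extension Φ of the normal computes the curvature at all nearby boundary points. -/
lemma continuousOn_curvature (hΩ : HasCmBoundary 2 Ω) (ho : IsOpen Ω) :
    ContinuousOn (curvature Ω) (frontier Ω) := by
  intro p hp
  have hΩ1 := hΩ.of_le one_le_two
  obtain ⟨Φ, hΦ, heq⟩ := exists_contDiff_normal (k := 1) hΩ ho hp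
  have hΦ1 : ContDiff ℝ 1 Φ := by exact_mod_cast hΦ
  have hΦ' := hΦ1.continuous_fderiv one_ne_zero
  have heq' : ∀ᶠ x in 𝓝[frontier Ω] p,
      curvature Ω x = ⟪fderiv ℝ Φ x (rot (Φ x)), rot (Φ x)⟫ := by
    filter_upwards [eventually_eventually_nhdsWithin.2 heq, self_mem_nhdsWithin] with x hx hxf
    rw [curvature_eq hΩ1 ho hxf ((hΦ1.differentiable one_ne_zero) x) hx, tangent,
      hx.self_of_nhdsWithin hxf]
  have hc : Continuous fun x => ⟪fderiv ℝ Φ x (rot (Φ x)), rot (Φ x)⟫ := by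
    have := hΦ1.continuous
    fun_prop
  exact hc.continuousWithinAt.congr_of_eventuallyEq heq' (heq'.self_of_nhdsWithin hp)

lemma hessianWeight_eq (f : Plane → ℝ) (Ω : Set Plane) : hessianWeight f Ω =
    fun p => fderiv ℝ f p (normal Ω p) + curvature Ω p * f p := by
  funext p
  rw [hessianWeight, inner_gradient_left]

lemma continuousOn_hessianWeight (hΩ : HasCmBoundary 2 Ω) (ho : IsOpen Ω) {f : Plane → ℝ}
    (hf : ContDiff ℝ 2 f) : ContinuousOn (hessianWeight f Ω) (frontier Ω) := by
  have h1 := continuousOn_normal (hΩ.of_le one_le_two) ho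
  have h2 := continuousOn_curvature hΩ ho
  have h3 : Continuous (fderiv ℝ f) := hf.continuous_fderiv two_ne_zero
  have h4 := hf.continuous.continuousOn (s := frontier Ω)
  rw [hessianWeight_eq]
  exact (h3.continuousOn.clm_apply h1).add (h2.mul h4)

/-- Differentiate ⟪V, τ⟫ = 0 along the boundary: ⟪∂_τ V, τ⟫ = -⟪V, ∂_τ τ⟫, where ∂_τ τ is the
rotated ∂_τ ν and V is a multiple of ν. This is how curvature enters the Hessian. -/
lemma inner_fderiv_tangent (hΩ : HasCmBoundary 2 Ω) (ho : IsOpen Ω) (hp : p ∈ frontier Ω)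
    {V : Plane → Plane} (hV : ContDiff ℝ 1 V) (hVt : ∀ x ∈ frontier Ω, ⟪V x, tangent Ω x⟫ = 0) :
    ⟪fderiv ℝ V p (tangent Ω p), tangent Ω p⟫ = curvature Ω p * ⟪V p, normal Ω p⟫ := by
  have hΩ1 := hΩ.of_le one_le_two
  obtain ⟨Φ, hΦ, heq⟩ := exists_contDiff_normal (k := 1) hΩ ho hp
  have hΦ1 : DifferentiableAt ℝ Φ p := (hΦ.differentiable (by simp)) p
  have hV1 : DifferentiableAt ℝ V p := (hV.differentiable one_ne_zero) p
  have hΦp : Φ p = normal Ω p := (heq.self_of_nhdsWithin hp).symm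
  have hR : HasFDerivAt (fun x => rot (Φ x)) (rotCLM ∘L fderiv ℝ Φ p) p :=
    rotCLM.hasFDerivAt.comp p hΦ1.hasFDerivAt
  have hu := hV1.hasFDerivAt.inner ℝ hR
  have h0 : ∀ᶠ x in 𝓝[frontier Ω] p, ⟪V x, rot (Φ x)⟫ = (fun _ => (0 : ℝ)) x := by
    filter_upwards [heq, self_mem_nhdsWithin] with x hx hxf
    rw [← hx]; exact hVt x hxf
  have key := fderiv_tangent_congr hΩ1 ho hp hu.differentiableAt
    (differentiableAt_const (0 : ℝ)) h0
  rw [hu.fderiv] at key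
  have hz : fderiv ℝ (fun _ : Plane => (0 : ℝ)) p (tangent Ω p) = 0 := by simp
  rw [hz, ContinuousLinearMap.comp_apply, ContinuousLinearMap.prod_apply, fderivInnerCLM_apply,
    hΦp] at key
  change ⟪V p, rot (fderiv ℝ Φ p (tangent Ω p))⟫ + ⟪fderiv ℝ V p (tangent Ω p), tangent Ω p⟫ = 0
    at key
  have hVp := inner_eq_zero_of_tangent (norm_normal hΩ1 ho hp) (hVt p hp)
  have h5 : ⟪V p, rot (fderiv ℝ Φ p (tangent Ω p))⟫
      = -(⟪V p, normal Ω p⟫ * ⟪fderiv ℝ Φ p (tangent Ω p), tangent Ω p⟫) := by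
    conv_lhs => rw [hVp]
    rw [inner_smul_left, inner_rot_right, real_inner_comm (tangent Ω p)]
    simp [tangent]
  rw [curvature_eq hΩ1 ho hp hΦ1 heq]
  linarith [h5, key]

end Normal

/-! ### Measure-preserving coordinates -/

/-- The orthonormal basis `(rot e, e)` of the plane. -/
def frame {e : Plane} (he : ‖e‖ = 1) : OrthonormalBasis (Fin 2) ℝ Plane :=
  OrthonormalBasis.mk (v := ![rot e, e])
    (by
      rw [orthonormal_iff_ite]
      intro i j
      fin_cases i <;> fin_cases j <;> simp [he, norm_rot])
    (by
      intro x _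
      rw [eq_inner_rot_add_inner he x]
      exact Submodule.add_mem _
        (Submodule.smul_mem _ _ (Submodule.subset_span ⟨0, rfl⟩))
        (Submodule.smul_mem _ _ (Submodule.subset_span ⟨1, rfl⟩)))

lemma measurePreserving_frame {e : Plane} (he : ‖e‖ = 1) :
    MeasurePreserving fun q : ℝ × ℝ => q.1 • rot e + q.2 • e := by
  have h := ((frame he).measurePreserving_repr_symm.comp
    (EuclideanSpace.volume_preserving_symm_measurableEquiv_toLp (Fin 2)).symm).comp
    (volume_preserving_finTwoArrow ℝ).symm
  have heq : (fun q : ℝ × ℝ => q.1 • rot e + q.2 • e) =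
      ((frame he).repr.symm ∘ (MeasurableEquiv.toLp 2 (Fin 2 → ℝ)).symm.symm) ∘
        MeasurableEquiv.finTwoArrow.symm := by
    funext q
    simp only [Function.comp_apply]
    rw [← (frame he).sum_repr_symm]
    simp [Fin.sum_univ_two, frame, MeasurableEquiv.finTwoArrow]
  rw [heq]
  exact h

/-- The region strictly below the graph of `g`. -/
def belowGraph (e : Plane) (g : ℝ → ℝ) : Set Plane := {x | ⟪x, e⟫ < g ⟪x, rot e⟫}

lemma mem_belowGraph {e : Plane} {g : ℝ → ℝ} {x : Plane} :
    x ∈ belowGraph e g ↔ ⟪x, e⟫ < g ⟪x, rot e⟫ := Iff.rfl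

lemma measurableSet_belowGraph (e : Plane) {g : ℝ → ℝ} (hg : Continuous g) :
    MeasurableSet (belowGraph e g) := (isOpen_lt (by fun_prop) (by fun_prop)).measurableSet

/-- Coordinates that flatten the graph of `g`. -/
def flatten {e : Plane} (he : ‖e‖ = 1) {g : ℝ → ℝ} (hg : Continuous g) : ℝ × ℝ ≃ₜ Plane where
  toFun q := graphCurve e g q.1 + q.2 • e
  invFun x := (⟪x, rot e⟫, ⟪x, e⟫ - g ⟪x, rot e⟫)
  left_inv q := by
    have h1 : ⟪graphCurve e g q.1 + q.2 • e, rot e⟫ = q.1 := by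
      rw [inner_add_left, inner_graphCurve_rot he, inner_smul_left, inner_self_rot]; simp
    have h2 : ⟪graphCurve e g q.1 + q.2 • e, e⟫ = g q.1 + q.2 := by
      rw [inner_add_left, inner_graphCurve he, inner_smul_left, real_inner_self_eq_norm_sq, he]
      simp
    dsimp only
    rw [h1, h2, add_sub_cancel_left]
  right_inv x := by
    conv_rhs => rw [eq_inner_rot_add_inner he x]
    simp only [graphCurve]
    rw [add_assoc, ← add_smul, add_sub_cancel]
  continuous_toFun := by unfold graphCurve; fun_prop
  continuous_invFun := by fun_prop

lemma flatten_apply {e : Plane} (he : ‖e‖ = 1) {g : ℝ → ℝ} (hg : Continuous g) (q : ℝ × ℝ) :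
    flatten he hg q = graphCurve e g q.1 + q.2 • e := rfl

/-- A shear that translates each vertical line, followed by an isometry. -/
lemma measurePreserving_flatten {e : Plane} (he : ‖e‖ = 1) {g : ℝ → ℝ} (hg : Continuous g) :
    MeasurePreserving (flatten he hg) := by
  have h := MeasurePreserving.skew_product (μa := volume) (μb := volume) (μc := volume)
    (μd := volume) (MeasurePreserving.id (volume : Measure ℝ)) (g := fun s y => g s + y)
    (by fun_prop) (Eventually.of_forall fun s => (measurePreserving_add_left volume (g s)).map_eq)
  have heq : ⇑(flatten he hg) = (fun q : ℝ × ℝ => q.1 • rot e + q.2 • e) ∘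
      fun p => (id p.1, g p.1 + p.2) := by
    funext q
    simp only [flatten_apply, graphCurve, Function.comp_apply, id, add_smul, add_assoc]
  rw [heq]
  exact (measurePreserving_frame he).comp h

lemma flatten_preimage {e : Plane} (he : ‖e‖ = 1) {g : ℝ → ℝ} (hg : Continuous g) :
    flatten he hg ⁻¹' belowGraph e g = univ ×ˢ Iio (0 : ℝ) := by
  ext q
  have h2 : ⟪flatten he hg q, e⟫ - g ⟪flatten he hg q, rot e⟫ = q.2 := by
    have := congrArg Prod.snd ((flatten he hg).left_inv q)
    exact this
  simp only [mem_preimage, mem_belowGraph, mem_prod, mem_univ, true_and, mem_Iio]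
  rw [← sub_neg, h2]

/-! ### The divergence theorem below a graph -/

lemma tr_eq_inner {e : Plane} (he : ‖e‖ = 1) (A : Plane →L[ℝ] Plane) :
    tr A = ⟪A (rot e), rot e⟫ + ⟪A e, e⟫ := by
  have h := sq_add_sq_of_norm_one he
  simp only [inner_plane, apply_eq_entry, rot_apply_zero, rot_apply_one, tr]
  linear_combination -(entry A 0 0 + entry A 1 1) * h

/-- In the flattening coordinates (s, y), of Jacobian one, div V = ∂_s⟪V, rot e⟫ + ∂_y⟪V, N(s)⟫ with
N the graph normal. By Fubini the first term integrates to zero over s and the second to its value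
at y = 0. The splitting never differentiates N, so g of class C¹ is enough. -/
lemma setIntegral_below_graph {e : Plane} (he : ‖e‖ = 1) {g : ℝ → ℝ} (hg : ContDiff ℝ 1 g)
    {V : Plane → Plane} (hV : ContDiff ℝ 1 V) (hc : HasCompactSupport V) :
    ∫ x in belowGraph e g, tr (fderiv ℝ V x)
      = ∫ s, ⟪V (graphCurve e g s), graphNormal e g s⟫ := by
  have hgc := hg.continuous
  have hg' : Continuous (deriv g) := hg.continuous_deriv le_rfl
  have hVc := hV.continuous
  have hV' := hV.continuous_fderiv one_ne_zero
  set T := flatten he hgc with hT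
  have hTc : Continuous T := T.continuous
  have hN : Continuous (graphNormal e g) := by unfold graphNormal; fun_prop
  have hVT : HasCompactSupport (V ∘ T) := hc.comp_homeomorph T
  have hDVT : HasCompactSupport (fderiv ℝ V ∘ T) := (hc.fderiv ℝ).comp_homeomorph T
  let As (q : ℝ × ℝ) : ℝ := ⟪fderiv ℝ V (T q) (rot (graphNormal e g q.1)), rot e⟫
  let By (q : ℝ × ℝ) : ℝ := ⟪fderiv ℝ V (T q) e, graphNormal e g q.1⟫
  have hAs : Continuous As := by simp only [As]; fun_prop
  have hBy : Continuous By := by simp only [By]; fun_prop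
  have hAsc : HasCompactSupport As := hDVT.mono fun q hq h => hq <| by
    have : fderiv ℝ V (T q) = 0 := h
    simp [As, this]
  have hByc : HasCompactSupport By := hDVT.mono fun q hq h => hq <| by
    have : fderiv ℝ V (T q) = 0 := h
    simp [By, this]
  have hAsi : Integrable As (volume.prod (volume.restrict (Iio (0 : ℝ)))) := by
    have := (hAs.integrable_of_hasCompactSupport hAsc (μ := volume)).integrableOn
      (s := univ ×ˢ Iio (0 : ℝ))
    rwa [IntegrableOn, Measure.volume_eq_prod, ← Measure.prod_restrict,
      Measure.restrict_univ] at this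
  have hByi : Integrable By (volume.prod (volume.restrict (Iio (0 : ℝ)))) := by
    have := (hBy.integrable_of_hasCompactSupport hByc (μ := volume)).integrableOn
      (s := univ ×ˢ Iio (0 : ℝ))
    rwa [IntegrableOn, Measure.volume_eq_prod, ← Measure.prod_restrict,
      Measure.restrict_univ] at this
  have hsplit (q : ℝ × ℝ) : tr (fderiv ℝ V (T q)) = As q + By q := by
    rw [tr_eq_inner he]
    simp only [As, By]
    rw [rot_graphNormal, map_add, map_smul, graphNormal, inner_add_left, inner_sub_right,
      real_inner_smul_left, real_inner_smul_right]
    ring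
  have hdT1 (s y : ℝ) : HasDerivAt (fun s => T (s, y)) (rot (graphNormal e g s)) s :=
    (hasDerivAt_graphCurve e hg s).add_const (y • e)
  have hdT2 (s y : ℝ) : HasDerivAt (fun y => T (s, y)) e y := by
    have := ((hasDerivAt_id' y).smul_const e).const_add (graphCurve e g s)
    rwa [one_smul] at this
  have hdV (x) : HasFDerivAt V (fderiv ℝ V x) x := ((hV.differentiable one_ne_zero) x).hasFDerivAt
  have hsec (s : ℝ) : IsClosedEmbedding fun y : ℝ => (s, y) :=
    (Isometry.of_dist_eq fun y z => by simp [Prod.dist_eq]).isClosedEmbedding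
  have hsec' (y : ℝ) : IsClosedEmbedding fun s : ℝ => (s, y) :=
    (Isometry.of_dist_eq fun s t => by simp [Prod.dist_eq]).isClosedEmbedding
  have h1 : ∫ x in belowGraph e g, tr (fderiv ℝ V x)
      = ∫ q, (As q + By q) ∂(volume.prod (volume.restrict (Iio (0 : ℝ)))) := by
    rw [← (measurePreserving_flatten he hgc).setIntegral_preimage_emb
      T.measurableEmbedding, flatten_preimage, Measure.volume_eq_prod, ← Measure.prod_restrict,
      Measure.restrict_univ]
    exact integral_congr_ae (Eventually.of_forall hsplit)
  have h2 : ∫ q, As q ∂(volume.prod (volume.restrict (Iio (0 : ℝ)))) = 0 := by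
    rw [integral_prod_symm _ hAsi]
    refine integral_eq_zero_of_ae (Eventually.of_forall fun y => ?_)
    have hd (s : ℝ) : HasDerivAt (fun s => ⟪V (T (s, y)), rot e⟫) (As (s, y)) s := by
      have h := ((hdV (T (s, y))).comp_hasDerivAt s (hdT1 s y)).inner ℝ
        (hasDerivAt_const s (rot e))
      simpa [As] using h
    refine integral_eq_zero_of_hasDerivAt_of_integrable hd ?_ ?_
    · exact (hAs.comp (hsec' y).continuous).integrable_of_hasCompactSupport
        (hAsc.comp_isClosedEmbedding (hsec' y))
    · refine Continuous.integrable_of_hasCompactSupport (by fun_prop) ?_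
      exact (hVT.comp_isClosedEmbedding (hsec' y)).comp_left (g := fun v => ⟪v, rot e⟫) (by simp)
  have h3 : ∫ q, By q ∂(volume.prod (volume.restrict (Iio (0 : ℝ))))
      = ∫ s, ⟪V (graphCurve e g s), graphNormal e g s⟫ := by
    rw [integral_prod _ hByi]
    refine integral_congr_ae (Eventually.of_forall fun s => ?_)
    have hd (y : ℝ) : HasDerivAt (fun y => ⟪V (T (s, y)), graphNormal e g s⟫) (By (s, y)) y := by
      have h := ((hdV (T (s, y))).comp_hasDerivAt y (hdT2 s y)).inner ℝ
        (hasDerivAt_const y (graphNormal e g s))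
      simpa [By] using h
    have hcs : HasCompactSupport fun y => ⟪V (T (s, y)), graphNormal e g s⟫ :=
      (hVT.comp_isClosedEmbedding (hsec s)).comp_left
        (g := fun v => ⟪v, graphNormal e g s⟫) (by simp)
    have hint : Integrable fun y => By (s, y) :=
      (hBy.comp (hsec s).continuous).integrable_of_hasCompactSupport
        (hByc.comp_isClosedEmbedding (hsec s))
    have hlim : Tendsto (fun y => ⟪V (T (s, y)), graphNormal e g s⟫) atBot (𝓝 0) := by
      have := hcs.is_zero_at_infty
      rw [cocompact_eq_atBot_atTop] at this
      exact this.mono_left le_sup_left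
    dsimp only
    rw [← integral_Iic_eq_integral_Iio, integral_Iic_of_hasDerivAt_of_tendsto
      (hd 0).continuousAt.continuousWithinAt (fun y _ => hd y) hint.integrableOn hlim, sub_zero]
    simp [hT, flatten_apply]
  rw [h1, integral_add hAsi hByi, h2, h3, zero_add]

lemma fderiv_eq_zero_of_notMem_tsupport {V : Plane → Plane} {x : Plane} (hx : x ∉ tsupport V) :
    fderiv ℝ V x = 0 :=
  image_eq_zero_of_notMem_tsupport fun h => hx (tsupport_fderiv_subset ℝ h)

@[simp] lemma tr_zero : tr 0 = 0 := by simp [tr, entry]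

lemma IsLocalGraph.setIntegral_tr {Ω : Set Plane} {p e : Plane} {g : ℝ → ℝ} {r : ℝ}
    (h : IsLocalGraph 1 Ω p e g r) (ho : IsOpen Ω) {V : Plane → Plane} (hV : ContDiff ℝ 1 V)
    (hs : tsupport V ⊆ Metric.ball p r) :
    ∫ x in Ω, tr (fderiv ℝ V x) = ∫ s, ⟪V (graphCurve e g s), graphNormal e g s⟫ := by
  have hc : HasCompactSupport V :=
    Metric.isCompact_of_isClosed_isBounded (isClosed_tsupport V) (Metric.isBounded_ball.subset hs)
  have hg : ContDiff ℝ 1 g := by exact_mod_cast h.smooth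
  have hgc := hg.continuous
  rw [← setIntegral_below_graph h.unit hg hV hc, ← integral_indicator ho.measurableSet,
    ← integral_indicator (measurableSet_belowGraph e hgc)]
  congr 1
  funext x
  by_cases hx : x ∈ tsupport V
  · have := h.below x (hs hx)
    by_cases hxΩ : x ∈ Ω
    · rw [indicator_of_mem hxΩ, indicator_of_mem (mem_belowGraph.2 (this.1 hxΩ))]
    · rw [indicator_of_notMem hxΩ, indicator_of_notMem fun h' => hxΩ (this.2 (mem_belowGraph.1 h'))]
  · simp [indicator, fderiv_eq_zero_of_notMem_tsupport hx]

/-- Replace `Ω` by a half-plane whose flat boundary lies beyond the support of V; the boundary term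
is then zero. -/
lemma setIntegral_tr_eq_zero {Ω : Set Plane} (ho : IsOpen Ω) {V : Plane → Plane}
    (hV : ContDiff ℝ 1 V) (hc : HasCompactSupport V) (hs : tsupport V ⊆ Ω) :
    ∫ x in Ω, tr (fderiv ℝ V x) = 0 := by
  obtain ⟨R, hR⟩ := hc.isBounded.subset_closedBall (0 : Plane)
  set e : Plane := EuclideanSpace.single 0 1
  have he : ‖e‖ = 1 := by simp [e]
  have hlt {x : Plane} (hx : x ∈ tsupport V) : ⟪x, e⟫ < R + 1 := by
    have h1 := hR hx
    rw [mem_closedBall_zero_iff] at h1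
    have h2 := real_inner_le_norm x e
    rw [he] at h2
    linarith
  have h := setIntegral_below_graph he (g := fun _ => R + 1) contDiff_const hV hc
  have h0 : ∫ s, ⟪V (graphCurve e (fun _ => R + 1) s), graphNormal e (fun _ => R + 1) s⟫ = 0 := by
    refine integral_eq_zero_of_ae (Eventually.of_forall fun s => ?_)
    have : V (graphCurve e (fun _ => R + 1) s) = 0 := by
      refine image_eq_zero_of_notMem_tsupport fun hx => ?_
      have := hlt hx
      rw [inner_graphCurve he] at this
      exact lt_irrefl _ this
    simp [this]
  rw [h0] at h
  rw [← h, ← integral_indicator ho.measurableSet, ← integral_indicator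
    (measurableSet_belowGraph e continuous_const)]
  congr 1
  funext x
  by_cases hx : x ∈ tsupport V
  · rw [indicator_of_mem (hs hx), indicator_of_mem (mem_belowGraph.2 (hlt hx))]
  · simp [indicator, fderiv_eq_zero_of_notMem_tsupport hx]

/-! ### A measure on the boundary for the divergence theorem -/

lemma exists_partition {ι : Type*} [Fintype ι] {K : Set Plane} (hK : IsClosed K)
    {U : ι → Set Plane} (hU : ∀ i, IsOpen (U i)) (hcov : K ⊆ ⋃ i, U i) :
    ∃ ρ : ι → Plane → ℝ, (∀ i, ContDiff ℝ 1 (ρ i)) ∧ (∀ i x, 0 ≤ ρ i x) ∧ (∀ i x, ρ i x ≤ 1) ∧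
      (∀ i, tsupport (ρ i) ⊆ U i) ∧ ∀ x ∈ K, ∑ i, ρ i x = 1 := by
  obtain ⟨ρ, hρ⟩ := SmoothPartitionOfUnity.exists_isSubordinate (modelWithCornersSelf ℝ Plane)
    hK U hU hcov
  refine ⟨fun i => ρ i, fun i => (ρ i).contMDiff.contDiff.of_le (by exact_mod_cast le_top),
    fun i x => ρ.nonneg i x, fun i x => ρ.le_one i x, hρ, fun x hx => ?_⟩
  rw [← ρ.sum_eq_one hx, finsum_eq_sum_of_fintype]

/-- The arc length of the graph of `g` weighted by `ρ`. -/
def graphMeasure (e : Plane) (g : ℝ → ℝ) (ρ : Plane → ℝ) : Measure Plane :=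
  (volume.withDensity fun s =>
    ENNReal.ofReal (ρ (graphCurve e g s) * ‖graphNormal e g s‖)).map (graphCurve e g)

/-- One-dimensional Hausdorff measure on the boundary of `Ω`. -/
def boundaryHausdorff (Ω : Set Plane) : Measure Plane :=
  (Measure.hausdorffMeasure 1).restrict (frontier Ω)

lemma continuous_graphCurve (e : Plane) {g : ℝ → ℝ} (hg : Continuous g) :
    Continuous (graphCurve e g) := by unfold graphCurve; fun_prop

lemma graphMeasure_apply {e : Plane} {g : ℝ → ℝ} (hg : ContDiff ℝ 1 g) {ρ : Plane → ℝ}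
    {A : Set Plane} (hA : MeasurableSet A) :
    graphMeasure e g ρ A = ∫⁻ s in graphCurve e g ⁻¹' A,
      ENNReal.ofReal (ρ (graphCurve e g s) * ‖graphNormal e g s‖) := by
  have hγ := continuous_graphCurve e hg.continuous
  rw [graphMeasure, Measure.map_apply hγ.measurable hA, withDensity_apply _ (hγ.measurable hA)]

lemma continuous_graphNormal (e : Plane) {g : ℝ → ℝ} (hg : ContDiff ℝ 1 g) :
    Continuous (graphNormal e g) := by
  have := hg.continuous_deriv le_rfl
  unfold graphNormal; fun_prop

lemma hausdorffMeasure_inner_image_le {e : Plane} (he : ‖e‖ = 1) (A : Set Plane) :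
    volume ((fun x : Plane => ⟪x, rot e⟫) '' A) ≤ Measure.hausdorffMeasure 1 A := by
  have hl : LipschitzWith 1 fun x : Plane => ⟪x, rot e⟫ := by
    refine LipschitzWith.of_dist_le_mul fun x y => ?_
    rw [Real.dist_eq, ← inner_sub_left, dist_eq_norm, NNReal.coe_one, one_mul]
    simpa [norm_rot, he] using abs_real_inner_le_norm (x - y) (rot e)
  have := (hl.lipschitzOnWith (s := A)).hausdorffMeasure_image_le (d := 1) zero_le_one
  rw [hausdorffMeasure_real] at this
  simpa using this

/-! ### Comparison of graph measures with Hausdorff measure. -/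

namespace IsLocalGraph

variable {Ω : Set Plane} {p e : Plane} {g : ℝ → ℝ} {r : ℝ} {ρ : Plane → ℝ}

lemma mem_Icc_of_graphCurve_mem (h : IsLocalGraph 1 Ω p e g r) {s : ℝ}
    (hs : graphCurve e g s ∈ Metric.ball p r) : s ∈ Icc (⟪p, rot e⟫ - r) (⟪p, rot e⟫ + r) := by
  rw [Metric.mem_ball, dist_eq_norm] at hs
  have h1 := abs_real_inner_le_norm (graphCurve e g s - p) (rot e)
  rw [inner_sub_left, inner_graphCurve_rot h.unit, norm_rot, h.unit, mul_one, abs_le] at h1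
  constructor <;> linarith [h1.1, h1.2]

lemma exists_lipschitz (h : IsLocalGraph 1 Ω p e g r) : ∃ M : NNReal,
    (∀ s, graphCurve e g s ∈ Metric.ball p r → ‖graphNormal e g s‖ ≤ M) ∧
    LipschitzOnWith M (graphCurve e g) (Icc (⟪p, rot e⟫ - r) (⟪p, rot e⟫ + r)) := by
  have hg : ContDiff ℝ 1 g := by exact_mod_cast h.smooth
  obtain ⟨M, hM⟩ := isCompact_Icc (a := ⟪p, rot e⟫ - r) (b := ⟪p, rot e⟫ + r)
    |>.exists_bound_of_continuousOn (continuous_graphNormal e hg).continuousOn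
  refine ⟨M.toNNReal, fun s hs =>
    (hM s (h.mem_Icc_of_graphCurve_mem hs)).trans (Real.le_coe_toNNReal M), ?_⟩
  refine (convex_Icc _ _).lipschitzOnWith_of_nnnorm_hasDerivWithin_le
    (fun s _ => (hasDerivAt_graphCurve e hg s).hasDerivWithinAt) fun s hs => ?_
  rw [← NNReal.coe_le_coe, coe_nnnorm, norm_rot]
  exact (hM s hs).trans (Real.le_coe_toNNReal M)

lemma graphMeasure_compl (h : IsLocalGraph 1 Ω p e g r) (ho : IsOpen Ω)
    (hs : tsupport ρ ⊆ Metric.ball p r) :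
    graphMeasure e g ρ (Metric.ball p r ∩ frontier Ω)ᶜ = 0 := by
  have hg : ContDiff ℝ 1 g := by exact_mod_cast h.smooth
  have hm : MeasurableSet (Metric.ball p r ∩ frontier Ω)ᶜ :=
    (measurableSet_ball.inter isClosed_frontier.measurableSet).compl
  rw [graphMeasure_apply hg hm]
  refine setLIntegral_eq_zero ((continuous_graphCurve e hg.continuous).measurable hm)
    fun s hsm => ?_
  have hnb : graphCurve e g s ∉ Metric.ball p r := fun hb =>
    hsm ⟨hb, h.graphCurve_mem_frontier ho hb⟩
  simp [image_eq_zero_of_notMem_tsupport fun hx => hnb (hs hx)]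

/-- The density is bounded by M on the chart ball, and projecting the curve to its parameter is
1-Lipschitz, hence does not increase one-dimensional Hausdorff measure. -/
lemma graphMeasure_le (h : IsLocalGraph 1 Ω p e g r) (ho : IsOpen Ω)
    (hρ : ∀ x, ρ x ≤ 1) (hs : tsupport ρ ⊆ Metric.ball p r) :
    ∃ M : NNReal, graphMeasure e g ρ ≤ M • boundaryHausdorff Ω := by
  have hg : ContDiff ℝ 1 g := by exact_mod_cast h.smooth
  have hγ := continuous_graphCurve e hg.continuous
  obtain ⟨M, hM, -⟩ := h.exists_lipschitz
  refine ⟨M, Measure.le_iff.2 fun A hA => ?_⟩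
  have hS : MeasurableSet (graphCurve e g ⁻¹' Metric.ball p r) := hγ.measurable measurableSet_ball
  rw [graphMeasure_apply hg hA]
  calc ∫⁻ s in graphCurve e g ⁻¹' A, ENNReal.ofReal (ρ (graphCurve e g s) * ‖graphNormal e g s‖)
      ≤ ∫⁻ s in graphCurve e g ⁻¹' A,
          (graphCurve e g ⁻¹' Metric.ball p r).indicator (fun _ => (M : ℝ≥0∞)) s := by
        refine lintegral_mono fun s => ?_
        by_cases hb : graphCurve e g s ∈ Metric.ball p r
        · rw [indicator_of_mem (mem_preimage.2 hb), ← ENNReal.ofReal_coe_nnreal]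
          refine ENNReal.ofReal_le_ofReal ?_
          calc ρ (graphCurve e g s) * ‖graphNormal e g s‖ ≤ 1 * ‖graphNormal e g s‖ :=
                mul_le_mul_of_nonneg_right (hρ _) (norm_nonneg _)
            _ ≤ M := by rw [one_mul]; exact hM s hb
        · simp [image_eq_zero_of_notMem_tsupport fun hx => hb (hs hx)]
    _ = M * volume (graphCurve e g ⁻¹' Metric.ball p r ∩ graphCurve e g ⁻¹' A) := by
        rw [lintegral_indicator_const hS, Measure.restrict_apply hS]
    _ ≤ M * Measure.hausdorffMeasure 1 (A ∩ frontier Ω) := by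
        gcongr
        refine (measure_mono ?_).trans (hausdorffMeasure_inner_image_le h.unit _)
        rintro s ⟨hb, hsA⟩
        exact ⟨_, ⟨hsA, h.graphCurve_mem_frontier ho hb⟩, inner_graphCurve_rot h.unit g s⟩
    _ = (M • boundaryHausdorff Ω) A := by
        rw [boundaryHausdorff, Measure.smul_apply, Measure.restrict_apply hA]; rfl

/-- The opposite comparison: the parametrisation is M-Lipschitz on the interval of parameters that
can reach the ball. -/
lemma restrict_boundaryHausdorff_le (h : IsLocalGraph 1 Ω p e g r) (ho : IsOpen Ω) :
    ∃ M : NNReal, (boundaryHausdorff Ω).restrict (Metric.ball p r) ≤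
      M • (volume : Measure ℝ).map (graphCurve e g) := by
  have hg : ContDiff ℝ 1 g := by exact_mod_cast h.smooth
  have hγ := continuous_graphCurve e hg.continuous
  obtain ⟨M, -, hM⟩ := h.exists_lipschitz
  refine ⟨M, Measure.le_iff.2 fun A hA => ?_⟩
  rw [Measure.restrict_apply hA, boundaryHausdorff,
    Measure.restrict_apply (hA.inter measurableSet_ball), Measure.smul_apply,
    Measure.map_apply hγ.measurable hA]
  set I := Icc (⟪p, rot e⟫ - r) (⟪p, rot e⟫ + r)
  have hsub : A ∩ Metric.ball p r ∩ frontier Ω ⊆ graphCurve e g '' (graphCurve e g ⁻¹' A ∩ I) := by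
    rintro x ⟨⟨hxA, hxb⟩, hxf⟩
    have hx := h.graphCurve_inner ho hxb hxf
    refine ⟨⟪x, rot e⟫, ⟨by rwa [mem_preimage, hx], ?_⟩, hx⟩
    exact h.mem_Icc_of_graphCurve_mem (by rwa [hx])
  calc _ ≤ Measure.hausdorffMeasure 1 (graphCurve e g '' (graphCurve e g ⁻¹' A ∩ I)) :=
        measure_mono hsub
    _ ≤ (M : ℝ≥0∞) ^ (1 : ℝ) * Measure.hausdorffMeasure 1 (graphCurve e g ⁻¹' A ∩ I) :=
        (hM.mono inter_subset_right).hausdorffMeasure_image_le zero_le_one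
    _ ≤ M * volume (graphCurve e g ⁻¹' A) := by
        rw [ENNReal.rpow_one, hausdorffMeasure_real]
        gcongr
        exact inter_subset_left

lemma setLIntegral_boundaryHausdorff_le (h : IsLocalGraph 1 Ω p e g r) (ho : IsOpen Ω)
    (hρc : Continuous ρ) (hρ : ∀ x, 0 ≤ ρ x) (hs : tsupport ρ ⊆ Metric.ball p r) :
    ∃ M : NNReal, ∀ A, MeasurableSet A →
      ∫⁻ x in A, ENNReal.ofReal (ρ x) ∂boundaryHausdorff Ω ≤ M * graphMeasure e g ρ A := by
  have hg : ContDiff ℝ 1 g := by exact_mod_cast h.smooth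
  have hγ := continuous_graphCurve e hg.continuous
  obtain ⟨M, hM⟩ := h.restrict_boundaryHausdorff_le ho
  refine ⟨M, fun A hA => ?_⟩
  have hzero : ∀ x ∉ Metric.ball p r, A.indicator (fun x => ENNReal.ofReal (ρ x)) x = 0 := by
    intro x hx
    simp [indicator, image_eq_zero_of_notMem_tsupport fun hx' => hx (hs hx')]
  have hmeas : Measurable (A.indicator fun x => ENNReal.ofReal (ρ x)) :=
    (hρc.measurable.ennreal_ofReal).indicator hA
  calc ∫⁻ x in A, ENNReal.ofReal (ρ x) ∂boundaryHausdorff Ω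
      = ∫⁻ x, A.indicator (fun x => ENNReal.ofReal (ρ x)) x
          ∂(boundaryHausdorff Ω).restrict (Metric.ball p r) := by
        rw [← lintegral_indicator hA, ← lintegral_indicator measurableSet_ball]
        congr 1
        funext x
        by_cases hx : x ∈ Metric.ball p r
        · rw [indicator_of_mem hx]
        · rw [indicator_of_notMem hx, hzero x hx]
    _ ≤ ∫⁻ x, A.indicator (fun x => ENNReal.ofReal (ρ x)) x
          ∂(M • (volume : Measure ℝ).map (graphCurve e g)) := lintegral_mono' hM le_rfl
    _ = M * ∫⁻ s in graphCurve e g ⁻¹' A, ENNReal.ofReal (ρ (graphCurve e g s)) := by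
        rw [lintegral_smul_measure, lintegral_map hmeas hγ.measurable,
          ← lintegral_indicator (hγ.measurable hA)]
        rfl
    _ ≤ M * graphMeasure e g ρ A := by
        rw [graphMeasure_apply hg hA]
        gcongr with s
        exact le_mul_of_one_le_right (hρ _) (one_le_norm_graphNormal h.unit g s)

lemma isFiniteMeasure_graphMeasure (h : IsLocalGraph 1 Ω p e g r)
    (hρc : Continuous ρ) (hs : tsupport ρ ⊆ Metric.ball p r) :
    IsFiniteMeasure (graphMeasure e g ρ) := by
  have hg : ContDiff ℝ 1 g := by exact_mod_cast h.smooth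
  have hγ := continuous_graphCurve e hg.continuous
  have hN := continuous_graphNormal e hg
  have hint : Integrable fun s => ρ (graphCurve e g s) * ‖graphNormal e g s‖ := by
    refine Continuous.integrable_of_hasCompactSupport (by fun_prop) ?_
    refine HasCompactSupport.intro (isCompact_Icc (a := ⟪p, rot e⟫ - r) (b := ⟪p, rot e⟫ + r))
      fun s hsI => ?_
    have hb : graphCurve e g s ∉ Metric.ball p r := fun hb => hsI (h.mem_Icc_of_graphCurve_mem hb)
    simp [image_eq_zero_of_notMem_tsupport fun hx => hb (hs hx)]
  have := isFiniteMeasure_withDensity_ofReal hint.hasFiniteIntegral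
  exact Measure.isFiniteMeasure_map _ _

/-- The factor ‖N‖ in the density cancels the normalisation of the unit normal, leaving the boundary
term of the divergence theorem for ρV. -/
lemma integral_graphMeasure (h : IsLocalGraph 1 Ω p e g r) (ho : IsOpen Ω)
    (hρ1 : ContDiff ℝ 1 ρ) (hρ : ∀ x, 0 ≤ ρ x) (hs : tsupport ρ ⊆ Metric.ball p r)
    {V : Plane → Plane} (hV : ContDiff ℝ 1 V) :
    Integrable (fun x => ⟪V x, normal Ω x⟫) (graphMeasure e g ρ) ∧
    ∫ x, ⟪V x, normal Ω x⟫ ∂graphMeasure e g ρ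
      = ∫ x in Ω, tr (fderiv ℝ (fun y => ρ y • V y) x) := by
  have hg : ContDiff ℝ 1 g := by exact_mod_cast h.smooth
  have hγ := continuous_graphCurve e hg.continuous
  have hN := continuous_graphNormal e hg
  have hρc := hρ1.continuous
  have hVc := hV.continuous
  have hu : Continuous (unitGraphNormal e g) :=
    (contDiff_unitGraphNormal (k := 0) h.unit h.smooth).continuous
  have hae : (fun x => ⟪V x, normal Ω x⟫) =ᵐ[graphMeasure e g ρ]
      fun x => ⟪V x, unitGraphNormal e g ⟪x, rot e⟫⟫ := by
    have : ∀ᵐ x ∂graphMeasure e g ρ, x ∈ Metric.ball p r ∩ frontier Ω :=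
      h.graphMeasure_compl ho hs
    filter_upwards [this] with x hx
    rw [h.normal_eq le_rfl ho hx.1 hx.2]
  have hcont : Continuous fun x => ⟪V x, unitGraphNormal e g ⟪x, rot e⟫⟫ := by fun_prop
  have hfin := h.isFiniteMeasure_graphMeasure hρc hs
  constructor
  · refine Integrable.congr ?_ hae.symm
    have h1 : IntegrableOn (fun x => ⟪V x, unitGraphNormal e g ⟪x, rot e⟫⟫)
        (Metric.closedBall p r) (graphMeasure e g ρ) :=
      hcont.continuousOn.integrableOn_compact (isCompact_closedBall p r)
    rwa [IntegrableOn, Measure.restrict_eq_self_of_ae_mem] at h1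
    have : ∀ᵐ x ∂graphMeasure e g ρ, x ∈ Metric.ball p r ∩ frontier Ω :=
      h.graphMeasure_compl ho hs
    exact this.mono fun x hx => Metric.ball_subset_closedBall hx.1
  · have hts : tsupport (fun y => ρ y • V y) ⊆ Metric.ball p r :=
      (tsupport_smul_subset_left ρ V).trans hs
    have hρV : ContDiff ℝ 1 fun y => ρ y • V y := hρ1.smul hV
    rw [h.setIntegral_tr ho hρV hts, integral_congr_ae hae, graphMeasure,
      integral_map hγ.aemeasurable hcont.aestronglyMeasurable,
      integral_withDensity_eq_integral_toReal_smul (by fun_prop)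
        (Eventually.of_forall fun s => ENNReal.ofReal_lt_top)]
    refine integral_congr_ae (Eventually.of_forall fun s => ?_)
    have h1 := one_le_norm_graphNormal h.unit g s
    dsimp only
    rw [ENNReal.toReal_ofReal (mul_nonneg (hρ _) (norm_nonneg _)), inner_graphCurve_rot h.unit,
      unitGraphNormal, real_inner_smul_right, real_inner_smul_left, smul_eq_mul]
    field_simp

end IsLocalGraph

/-- A finite measure on the boundary of `Ω` that is comparable with the Hausdorff measure and for
which the divergence theorem holds. -/
structure IsBoundaryMeasure (Ω : Set Plane) (σ : Measure Plane) : Prop where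
  finite : IsFiniteMeasure σ
  compl : σ (frontier Ω)ᶜ = 0
  le : ∃ C : NNReal, σ ≤ C • boundaryHausdorff Ω
  ge : ∃ C : NNReal, boundaryHausdorff Ω ≤ C • σ
  divergence : ∀ V : Plane → Plane, ContDiff ℝ 1 V →
    ∫ x in Ω, tr (fderiv ℝ V x) = ∫ x, ⟪V x, normal Ω x⟫ ∂σ

lemma tr_sum {ι : Type*} (s : Finset ι) (A : ι → Plane →L[ℝ] Plane) :
    tr (∑ i ∈ s, A i) = ∑ i ∈ s, tr (A i) := by
  simp [tr, entry, Finset.sum_add_distrib]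

/-- A partition of unity on closure Ω, subordinate to `Ω` and finitely many chart balls, localises
the divergence theorem. The interior piece contributes nothing, and σ is the sum of the weighted
chart measures. -/
theorem exists_isBoundaryMeasure {Ω : Set Plane} (hb : Bornology.IsBounded Ω) (ho : IsOpen Ω)
    (hΩ : HasCmBoundary 1 Ω) : ∃ σ, IsBoundaryMeasure Ω σ := by
  choose e g r hloc using fun p : frontier Ω => hΩ p p.2
  have hcl : IsCompact (closure Ω) := hb.isCompact_closure
  have hfc : IsCompact (frontier Ω) := hcl.of_isClosed_subset isClosed_frontier
    frontier_subset_closure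
  obtain ⟨t, ht⟩ := hfc.elim_finite_subcover (fun p : frontier Ω => Metric.ball (p : Plane) (r p))
    (fun _ => Metric.isOpen_ball) fun x hx =>
      mem_iUnion.2 ⟨⟨x, hx⟩, Metric.mem_ball_self (hloc ⟨x, hx⟩).pos⟩
  let U : Option t → Set Plane := fun i => i.elim Ω fun p => Metric.ball (p : Plane) (r p)
  have hU : ∀ i, IsOpen (U i) := by
    rintro (_ | p)
    · exact ho
    · exact Metric.isOpen_ball
  have hcov : closure Ω ⊆ ⋃ i, U i := by
    rw [closure_eq_self_union_frontier]
    rintro x (hx | hx)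
    · exact mem_iUnion.2 ⟨none, hx⟩
    · obtain ⟨p, hp, hxp⟩ := mem_iUnion₂.1 (ht hx)
      exact mem_iUnion.2 ⟨some ⟨p, hp⟩, hxp⟩
  obtain ⟨ρ, hρ1, hρ0, hρle, hρs, hρsum⟩ := exists_partition isClosed_closure hU hcov
  -- The interior function is supported in the open set `Ω`, so on the boundary the chart functions
  -- alone sum to one.
  have hnone : ∀ x ∈ frontier Ω, ρ none x = 0 := fun x hx =>
    image_eq_zero_of_notMem_tsupport fun h => by
      rw [ho.frontier_eq] at hx
      exact hx.2 (hρs none h)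
  have hsum : ∀ x ∈ frontier Ω, ∑ p : t, ρ (some p) x = 1 := by
    intro x hx
    rw [← hρsum x (frontier_subset_closure hx), Fintype.sum_option, hnone x hx, zero_add]
  let μ (p : t) : Measure Plane := graphMeasure (e p) (g p) (ρ (some p))
  have hfin (p : t) : IsFiniteMeasure (μ p) :=
    (hloc p).isFiniteMeasure_graphMeasure (hρ1 _).continuous (hρs (some p))
  have hint (V : Plane → Plane) (hV : ContDiff ℝ 1 V) (p : t) :=
    (hloc p).integral_graphMeasure ho (hρ1 (some p)) (hρ0 _) (hρs (some p)) hV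
  refine ⟨∑ p, μ p, ⟨?_, ?_, ?_, ?_, ?_⟩⟩
  · refine ⟨?_⟩
    rw [Measure.finsetSum_apply]
    exact ENNReal.sum_lt_top.2 fun p _ => measure_lt_top (μ p) univ
  · rw [Measure.finsetSum_apply]
    refine Finset.sum_eq_zero fun p _ => ?_
    exact measure_mono_null (compl_subset_compl.2 inter_subset_right)
      ((hloc p).graphMeasure_compl ho (hρs (some p)))
  · choose M hM using fun p : t => (hloc p).graphMeasure_le ho (hρle (some p)) (hρs (some p))
    refine ⟨∑ p, M p, Measure.le_iff.2 fun A _ => ?_⟩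
    rw [Measure.finsetSum_apply, Finset.sum_smul, Measure.finsetSum_apply]
    exact Finset.sum_le_sum fun p _ => hM p A
  · choose M hM using fun p : t => (hloc p).setLIntegral_boundaryHausdorff_le ho
      (hρ1 (some p)).continuous (hρ0 (some p)) (hρs (some p))
    refine ⟨∑ p, M p, Measure.le_iff.2 fun A hA => ?_⟩
    have hae : ∀ᵐ x ∂(boundaryHausdorff Ω).restrict A,
        (1 : ℝ≥0∞) = ∑ p : t, ENNReal.ofReal (ρ (some p) x) := by
      refine ae_restrict_of_ae ?_
      refine (ae_restrict_mem isClosed_frontier.measurableSet).mono fun x hx => ?_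
      rw [← ENNReal.ofReal_sum_of_nonneg fun p _ => hρ0 _ _, hsum x hx, ENNReal.ofReal_one]
    calc boundaryHausdorff Ω A = ∫⁻ x in A, 1 ∂boundaryHausdorff Ω := by
          rw [setLIntegral_one]
      _ = ∑ p : t, ∫⁻ x in A, ENNReal.ofReal (ρ (some p) x) ∂boundaryHausdorff Ω := by
          rw [lintegral_congr_ae hae, lintegral_finsetSum _ fun p _ =>
            (hρ1 (some p)).continuous.measurable.ennreal_ofReal]
      _ ≤ ∑ p : t, ((∑ q, M q : NNReal) : ℝ≥0∞) * μ p A := by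
          refine Finset.sum_le_sum fun p _ => (hM p A hA).trans ?_
          gcongr
          exact Finset.single_le_sum (f := M) (fun _ _ => zero_le) (Finset.mem_univ p)
      _ = ((∑ p, M p) • ∑ p, μ p) A := by
          rw [← Finset.mul_sum, Measure.smul_apply, Measure.finsetSum_apply]; rfl
  · intro V hV
    have hρV (i) : ContDiff ℝ 1 fun y => ρ i y • V y := (hρ1 i).smul hV
    have h1 : ∀ x ∈ Ω, tr (fderiv ℝ V x) = ∑ i, tr (fderiv ℝ (fun y => ρ i y • V y) x) := by
      intro x hx
      have heq : V =ᶠ[𝓝 x] fun y => ∑ i, ρ i y • V y := by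
        filter_upwards [ho.mem_nhds hx] with y hy
        rw [← Finset.sum_smul, hρsum y (subset_closure hy), one_smul]
      rw [heq.fderiv_eq, fderiv_fun_sum fun i _ => (hρV i).differentiable one_ne_zero x, tr_sum]
    have hi (i) : IntegrableOn (fun x => tr (fderiv ℝ (fun y => ρ i y • V y) x)) Ω :=
      integrableOn_of_continuous hb
        (continuous_tr.comp ((hρV i).continuous_fderiv one_ne_zero))
    have hzero : ∫ x in Ω, tr (fderiv ℝ (fun y => ρ none y • V y) x) = 0 := by
      have hts : tsupport (fun y => ρ none y • V y) ⊆ Ω :=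
        (tsupport_smul_subset_left (ρ none) V).trans (hρs none)
      exact setIntegral_tr_eq_zero ho (hρV none)
        (Metric.isCompact_of_isClosed_isBounded (isClosed_tsupport _) (hb.subset hts)) hts
    rw [setIntegral_congr_fun ho.measurableSet h1, integral_finsetSum _ fun i _ => hi i,
      Fintype.sum_option, hzero, zero_add, integral_finsetSum_measure fun p _ => (hint V hV p).1]
    exact Finset.sum_congr rfl fun p _ => (hint V hV p).2.symm

namespace IsBoundaryMeasure

variable {Ω : Set Plane} {σ : Measure Plane}

lemma ae_mem_frontier (hσ : IsBoundaryMeasure Ω σ) : ∀ᵐ x ∂σ, x ∈ frontier Ω := hσ.compl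

lemma integrable (hσ : IsBoundaryMeasure Ω σ) (hb : Bornology.IsBounded Ω) {u : Plane → ℝ}
    (hu : ContinuousOn u (frontier Ω)) : Integrable u σ := by
  have hfc : IsCompact (frontier Ω) := hb.isCompact_closure.of_isClosed_subset isClosed_frontier
    frontier_subset_closure
  have := hσ.finite
  have h : IntegrableOn u (frontier Ω) σ := hu.integrableOn_compact hfc
  rwa [IntegrableOn, Measure.restrict_eq_self_of_ae_mem hσ.ae_mem_frontier] at h

lemma measure_singleton (hσ : IsBoundaryMeasure Ω σ) (x : Plane) : σ {x} = 0 := by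
  obtain ⟨C, hC⟩ := hσ.le
  refine le_antisymm ((hC {x}).trans ?_) zero_le
  have : NullSingletonClass (Measure.hausdorffMeasure 1 : Measure Plane) :=
    Measure.nullSingletonClass_hausdorff Plane one_pos
  rw [Measure.smul_apply, boundaryHausdorff, MeasureTheory.measure_singleton, smul_zero]

/-- A neighbourhood of p contains the image of an open parameter set, whose length bounds its
Hausdorff measure from below. This upgrades σ-a.e. identities of continuous functions to pointwise
ones. -/
lemma measure_pos (hσ : IsBoundaryMeasure Ω σ) (ho : IsOpen Ω) (hΩ : HasCmBoundary 1 Ω)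
    {p : Plane} (hp : p ∈ frontier Ω) {U : Set Plane} (hU : U ∈ 𝓝 p) : 0 < σ U := by
  obtain ⟨e, g, r, h⟩ := hΩ p hp
  have hγ := continuous_graphCurve e h.smooth.continuous
  have hγp := h.graphCurve_inner ho (Metric.mem_ball_self h.pos) hp
  obtain ⟨T, hTU, hTo, hpT⟩ := mem_nhds_iff.1 (inter_mem hU (Metric.ball_mem_nhds p h.pos))
  have h1 : 0 < volume (graphCurve e g ⁻¹' T) :=
    (hTo.preimage hγ).measure_pos volume ⟨⟪p, rot e⟫, by rwa [mem_preimage, hγp]⟩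
  have h2 : volume (graphCurve e g ⁻¹' T) ≤ boundaryHausdorff Ω T := by
    rw [boundaryHausdorff, Measure.restrict_apply hTo.measurableSet]
    refine (measure_mono fun s hs => ?_).trans (hausdorffMeasure_inner_image_le h.unit _)
    exact ⟨_, ⟨hs, h.graphCurve_mem_frontier ho (hTU hs).2⟩, inner_graphCurve_rot h.unit g s⟩
  obtain ⟨C, hC⟩ := hσ.ge
  refine pos_iff_ne_zero.2 fun h0 => ?_
  have h3 : boundaryHausdorff Ω T ≤ 0 := by
    refine (hC T).trans ?_
    rw [Measure.smul_apply, measure_mono_null (hTU.trans inter_subset_left) h0, smul_zero]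
  exact absurd (h1.trans_le (h2.trans h3)) (lt_irrefl 0)

lemma eq_zero_of_ae (hσ : IsBoundaryMeasure Ω σ) (ho : IsOpen Ω) (hΩ : HasCmBoundary 1 Ω)
    {u : Plane → ℝ} (hu : ContinuousOn u (frontier Ω)) (h0 : ∀ᵐ x ∂σ, u x = 0)
    {p : Plane} (hp : p ∈ frontier Ω) : u p = 0 := by
  by_contra hne
  obtain ⟨U, hU, hUne⟩ := mem_nhdsWithin_iff_exists_mem_nhds_inter.1
    ((hu p hp).eventually_ne hne)
  have hpos := hσ.measure_pos ho hΩ hp hU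
  have hz : σ U = 0 := by
    refine measure_mono_null (t := {x | ¬ (u x = 0 ∧ x ∈ frontier Ω)}) ?_
      (h0.and hσ.ae_mem_frontier)
    intro x hx h
    exact hUne ⟨hx, h.2⟩ h.1
  exact hpos.ne' hz

end IsBoundaryMeasure

/-! ### Approximation by smooth vector fields -/

/-- Mollification: convolution with a narrow bump commutes with the derivative, and both W and its
derivative are uniformly continuous. -/
lemma exists_contDiff_approx {W : Plane → Plane} (hW : ContDiff ℝ 1 W) (hc : HasCompactSupport W)
    {ε : ℝ} (hε : 0 < ε) : ∃ W' : Plane → Plane, ContDiff ℝ 2 W' ∧ (∀ x, ‖W' x - W x‖ ≤ ε) ∧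
      ∀ x, ‖fderiv ℝ W' x - fderiv ℝ W x‖ ≤ ε := by
  have hD : Continuous (fderiv ℝ W) := hW.continuous_fderiv one_ne_zero
  have h1 := hc.uniformContinuous_of_continuous hW.continuous
  have h2 := (hc.fderiv ℝ).uniformContinuous_of_continuous hD
  obtain ⟨δ₁, hδ₁, hd₁⟩ := Metric.uniformContinuous_iff.1 h1 ε hε
  obtain ⟨δ₂, hδ₂, hd₂⟩ := Metric.uniformContinuous_iff.1 h2 ε hε
  have hδ := lt_min hδ₁ hδ₂
  let φ : ContDiffBump (0 : Plane) := ⟨min δ₁ δ₂ / 2, min δ₁ δ₂, half_pos hδ, half_lt_self hδ⟩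
  have hφc : HasCompactSupport (φ.normed volume) := φ.hasCompactSupport_normed
  have hφd : ContDiff ℝ 2 (φ.normed volume) := φ.contDiff_normed
  have hpre : (ContinuousLinearMap.lsmul ℝ ℝ : ℝ →L[ℝ] Plane →L[ℝ] Plane).precompR Plane
      = ContinuousLinearMap.lsmul ℝ ℝ := by
    ext; simp
  refine ⟨convolution (φ.normed volume) W (ContinuousLinearMap.lsmul ℝ ℝ) volume, ?_, ?_, ?_⟩
  · exact_mod_cast hφc.contDiff_convolution_left (n := 2) _ hφd hW.continuous.locallyIntegrable
  · intro x
    rw [← dist_eq_norm]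
    refine φ.dist_normed_convolution_le hW.continuous.aestronglyMeasurable fun y hy => ?_
    exact (hd₁ ((Metric.mem_ball.1 hy).trans_le (min_le_left _ _))).le
  · intro x
    have := hc.hasFDerivAt_convolution_right (ContinuousLinearMap.lsmul ℝ ℝ) (μ := volume)
      (f := φ.normed volume) hφd.continuous.locallyIntegrable hW x
    rw [this.fderiv, hpre, ← dist_eq_norm]
    refine φ.dist_normed_convolution_le hD.aestronglyMeasurable fun y hy => ?_
    exact (hd₂ ((Metric.mem_ball.1 hy).trans_le (min_le_right _ _))).le

lemma tendsto_integral_jet {μ : Measure Plane} [IsFiniteMeasure μ] {K : Set Plane}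
    (hK : IsCompact K) (hμ : ∀ᵐ x ∂μ, x ∈ K) {S : Plane → Plane → (Plane →L[ℝ] Plane) → ℝ}
    (hS : ContinuousOn (fun q : Plane × Plane × (Plane →L[ℝ] Plane) => S q.1 q.2.1 q.2.2)
      (K ×ˢ univ)) {X : Plane → Plane} (hX : ContDiff ℝ 1 X) {Z : ℕ → Plane → Plane}
    (hZ : ∀ n, ContDiff ℝ 1 (Z n)) (h0 : ∀ n x, ‖Z n x - X x‖ ≤ 1 / ((n : ℝ) + 1))
    (h1 : ∀ n x, ‖fderiv ℝ (Z n) x - fderiv ℝ X x‖ ≤ 1 / ((n : ℝ) + 1)) :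
    Tendsto (fun n => ∫ x, S x (Z n x) (fderiv ℝ (Z n) x) ∂μ) atTop
      (𝓝 (∫ x, S x (X x) (fderiv ℝ X x) ∂μ)) := by
  have hX' := hX.continuous_fderiv one_ne_zero
  obtain ⟨R, hR⟩ := hK.exists_bound_of_continuousOn hX.continuous.continuousOn
  obtain ⟨R', hR'⟩ := hK.exists_bound_of_continuousOn hX'.continuousOn
  have hle (n : ℕ) : 1 / ((n : ℝ) + 1) ≤ 1 := by
    rw [div_le_one (by positivity)]; linarith [n.cast_nonneg (α := ℝ)]
  -- All approximating jets over K lie in this compact set, since the errors are at most 1; a bound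
  -- for S there dominates the integrands.
  have hcpt : IsCompact (K ×ˢ (Metric.closedBall (0 : Plane) (R + 1) ×ˢ
      Metric.closedBall (0 : Plane →L[ℝ] Plane) (R' + 1))) :=
    hK.prod ((isCompact_closedBall _ _).prod (isCompact_closedBall _ _))
  obtain ⟨C, hC⟩ := hcpt.exists_bound_of_continuousOn
    (hS.mono (prod_mono_right (subset_univ _)))
  have hmeas (Y : Plane → Plane) (hY : ContDiff ℝ 1 Y) :
      AEStronglyMeasurable (fun x => S x (Y x) (fderiv ℝ Y x)) μ := by
    have hY' := hY.continuous_fderiv one_ne_zero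
    have hYc := hY.continuous
    have hc : ContinuousOn (fun x => S x (Y x) (fderiv ℝ Y x)) K :=
      hS.comp (f := fun x => (x, Y x, fderiv ℝ Y x)) (by fun_prop) fun x hx => ⟨hx, mem_univ _⟩
    have := hc.aestronglyMeasurable (μ := μ) hK.isClosed.measurableSet
    rwa [Measure.restrict_eq_self_of_ae_mem hμ] at this
  refine tendsto_integral_of_dominated_convergence (fun _ => C) (fun n => hmeas _ (hZ n))
    (integrable_const C) (fun n => ?_) ?_
  · filter_upwards [hμ] with x hx
    refine hC (x, Z n x, fderiv ℝ (Z n) x) ⟨hx, ?_, ?_⟩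
    · rw [mem_closedBall_zero_iff]
      calc ‖Z n x‖ = ‖X x + (Z n x - X x)‖ := by rw [add_sub_cancel]
        _ ≤ ‖X x‖ + ‖Z n x - X x‖ := norm_add_le _ _
        _ ≤ R + 1 := add_le_add (hR x hx) ((h0 n x).trans (hle n))
    · rw [mem_closedBall_zero_iff]
      calc ‖fderiv ℝ (Z n) x‖ = ‖fderiv ℝ X x + (fderiv ℝ (Z n) x - fderiv ℝ X x)‖ := by
            rw [add_sub_cancel]
        _ ≤ ‖fderiv ℝ X x‖ + ‖fderiv ℝ (Z n) x - fderiv ℝ X x‖ := norm_add_le _ _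
        _ ≤ R' + 1 := add_le_add (hR' x hx) ((h1 n x).trans (hle n))
  · filter_upwards [hμ] with x hx
    have t0 : Tendsto (fun n => Z n x) atTop (𝓝 (X x)) :=
      tendsto_iff_norm_sub_tendsto_zero.2 (squeeze_zero (fun _ => norm_nonneg _)
        (fun n => h0 n x) tendsto_one_div_add_atTop_nhds_zero_nat)
    have t1 : Tendsto (fun n => fderiv ℝ (Z n) x) atTop (𝓝 (fderiv ℝ X x)) :=
      tendsto_iff_norm_sub_tendsto_zero.2 (squeeze_zero (fun _ => norm_nonneg _)
        (fun n => h1 n x) tendsto_one_div_add_atTop_nhds_zero_nat)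
    have hSx : Continuous fun q : Plane × (Plane →L[ℝ] Plane) => S x q.1 q.2 := by
      rw [← continuousOn_univ]
      exact hS.comp (f := fun q : Plane × (Plane →L[ℝ] Plane) => (x, q.1, q.2)) (by fun_prop)
        fun q _ => ⟨hx, mem_univ _⟩
    exact (hSx.tendsto (X x, fderiv ℝ X x)).comp (t0.prodMk_nhds t1)

/-! ### The second shape derivative as a boundary integral -/

lemma tr_add (A B : Plane →L[ℝ] Plane) : tr (A + B) = tr A + tr B := by
  simp [tr]; ring

lemma tr_sub (A B : Plane →L[ℝ] Plane) : tr (A - B) = tr A - tr B := by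
  simp [tr, entry]; ring

lemma tr_smul (c : ℝ) (A : Plane →L[ℝ] Plane) : tr (c • A) = c * tr A := by
  simp [tr]; ring

lemma tr_smulRight (c : Plane →L[ℝ] ℝ) (v : Plane) : tr (c.smulRight v) = c v := by
  conv_rhs => rw [plane_eq v]
  simp [tr, entry, mul_comm]

/-- The trace as a continuous linear map. -/
def trCLM : (Plane →L[ℝ] Plane) →L[ℝ] ℝ where
  toFun := tr
  map_add' := tr_add
  map_smul' := tr_smul
  cont := continuous_tr

@[simp] lemma trCLM_apply (A : Plane →L[ℝ] Plane) : trCLM A = tr A := rfl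

lemma tr_fderiv_smul {h : Plane → ℝ} {Y : Plane → Plane} {x : Plane} {h' : Plane →L[ℝ] ℝ}
    {Y' : Plane →L[ℝ] Plane} (hh : HasFDerivAt h h' x) (hY : HasFDerivAt Y Y' x) :
    tr (fderiv ℝ (fun y => h y • Y y) x) = h x * tr Y' + h' (Y x) := by
  rw [(hh.fun_smul hY).fderiv, tr_add, tr_smul, tr_smulRight]

/-- A vector field whose divergence is the integrand of the second shape derivative. -/
def hessianField (f : Plane → ℝ) (X Y : Plane → Plane) (x : Plane) : Plane :=
  f x • (tr (fderiv ℝ X x) • Y x - fderiv ℝ X x (Y x)) + fderiv ℝ f x (X x) • Y x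

lemma contDiff_hessianField {f : Plane → ℝ} (hf : ContDiff ℝ 2 f) {X Y : Plane → Plane}
    (hX : ContDiff ℝ 2 X) (hY : ContDiff ℝ 1 Y) : ContDiff ℝ 1 (hessianField f X Y) := by
  have hf1 : ContDiff ℝ 1 f := hf.of_le one_le_two
  have hX1 : ContDiff ℝ 1 X := hX.of_le one_le_two
  have hf' : ContDiff ℝ 1 (fderiv ℝ f) := hf.fderiv_right (by norm_num)
  have hX' : ContDiff ℝ 1 (fderiv ℝ X) := hX.fderiv_right (by norm_num)
  have htr : ContDiff ℝ 1 fun x => tr (fderiv ℝ X x) := trCLM.contDiff.comp hX'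
  exact (hf1.smul ((htr.smul hY).sub (hX'.clm_apply hY))).add ((hf'.clm_apply hX1).smul hY)

/-- The terms with second derivatives of X cancel by their symmetry and the two terms Df(DX Y)
cancel each other; what remains of DX and DY is tr DX tr DY - tr(DX DY), the mixed determinant. -/
lemma tr_fderiv_hessianField {f : Plane → ℝ} (hf : ContDiff ℝ 2 f) {X Y : Plane → Plane}
    (hX : ContDiff ℝ 2 X) (hY : ContDiff ℝ 1 Y) (x : Plane) :
    tr (fderiv ℝ (hessianField f X Y) x) = secondVar f X Y x := by
  have hf' : ContDiff ℝ 1 (fderiv ℝ f) := hf.fderiv_right (by norm_num)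
  have hX' : ContDiff ℝ 1 (fderiv ℝ X) := hX.fderiv_right (by norm_num)
  have df := ((hf.differentiable two_ne_zero) x).hasFDerivAt
  have dX := ((hX.differentiable two_ne_zero) x).hasFDerivAt
  have dY := ((hY.differentiable one_ne_zero) x).hasFDerivAt
  have df' := ((hf'.differentiable one_ne_zero) x).hasFDerivAt
  have dX' := ((hX'.differentiable one_ne_zero) x).hasFDerivAt
  have dtr : HasFDerivAt (fun y => tr (fderiv ℝ X y)) (trCLM ∘L fderiv ℝ (fderiv ℝ X) x) x :=
    trCLM.hasFDerivAt.comp x dX'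
  have dU := (dtr.fun_smul dY).fun_sub (dX'.clm_apply dY)
  have dh := df'.clm_apply dX
  have hsym : ∀ v w, fderiv ℝ (fderiv ℝ X) x v w = fderiv ℝ (fderiv ℝ X) x w v :=
    hX.contDiffAt.isSymmSndFDerivAt (by simp)
  have e : fderiv ℝ (hessianField f X Y) x
      = fderiv ℝ (fun y => f y • (tr (fderiv ℝ X y) • Y y - fderiv ℝ X y (Y y))) x
        + fderiv ℝ (fun y => fderiv ℝ f y (X y) • Y y) x :=
    fderiv_fun_add (df.fun_smul dU).differentiableAt (dh.fun_smul dY).differentiableAt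
  have hflip : tr ((fderiv ℝ (fderiv ℝ X) x).flip (Y x)) = tr (fderiv ℝ (fderiv ℝ X) x (Y x)) := by
    simp [tr, entry, hsym (Y x)]
  have hmix (A B : Plane →L[ℝ] Plane) : mixedDet A B = tr A * tr B - tr (A ∘L B) := by
    simp [mixedDet, tr, entry_comp]; ring
  rw [e, tr_add, tr_fderiv_smul df dU, tr_fderiv_smul dh dY, tr_sub, tr_add, tr_add, tr_smul,
    tr_smulRight, hflip, secondVar, hmix]
  simp only [ContinuousLinearMap.comp_apply, _root_.add_apply,
    ContinuousLinearMap.flip_apply, trCLM_apply, map_sub, map_smul, smul_eq_mul]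
  ring

/-- The integrand on the boundary of the second shape derivative in the direction `(X, Y)`, with
`Y` normal, in terms of the one-jet of `X`. -/
def boundaryJet (f : Plane → ℝ) (Ω : Set Plane) (Y : Plane → Plane) (x v : Plane)
    (A : Plane →L[ℝ] Plane) : ℝ :=
  ⟪Y x, normal Ω x⟫ * (f x * ⟪A (tangent Ω x), tangent Ω x⟫ + fderiv ℝ f x v)

namespace IsBoundaryMeasure

variable {Ω : Set Plane} {σ : Measure Plane} {f : Plane → ℝ} {X Y : Plane → Plane}

/-- With Y = ⟪Y, ν⟫ν on the boundary, the normal part of (div X)Y - DX Y is ⟪Y, ν⟫(tr DX - ⟪DX ν,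
ν⟫) = ⟪Y, ν⟫⟪DX τ, τ⟫. -/
lemma setIntegral_secondVar_of_contDiff_two (hσ : IsBoundaryMeasure Ω σ) (ho : IsOpen Ω)
    (hΩ : HasCmBoundary 1 Ω) (hf : ContDiff ℝ 2 f) (hX : ContDiff ℝ 2 X) (hY : ContDiff ℝ 1 Y)
    (hYt : ∀ x ∈ frontier Ω, ⟪Y x, tangent Ω x⟫ = 0) :
    ∫ x in Ω, secondVar f X Y x = ∫ x, boundaryJet f Ω Y x (X x) (fderiv ℝ X x) ∂σ := by
  have h := hσ.divergence _ (contDiff_hessianField hf hX hY)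
  simp only [tr_fderiv_hessianField hf hX hY] at h
  rw [h]
  refine integral_congr_ae (hσ.ae_mem_frontier.mono fun x hx => ?_)
  have hn := norm_normal hΩ ho hx
  have hYx := inner_eq_zero_of_tangent hn (hYt x hx)
  have htr := tr_eq_inner hn (fderiv ℝ X x)
  have h2 : ⟪fderiv ℝ X x (Y x), normal Ω x⟫
      = ⟪Y x, normal Ω x⟫ * ⟪fderiv ℝ X x (normal Ω x), normal Ω x⟫ := by
    conv_lhs => rw [hYx, map_smul, real_inner_smul_left]
  dsimp only
  rw [hessianField, inner_add_left, real_inner_smul_left, inner_sub_left, real_inner_smul_left,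
    real_inner_smul_left, h2, htr, boundaryJet, tangent]
  ring

/-- Both sides depend continuously on X in the C¹ norm. The boundary integrand is kept in terms of
the full jet of X because the C² approximants need not be normal on the boundary. -/
lemma setIntegral_secondVar_eq_jet (hσ : IsBoundaryMeasure Ω σ) (hb : Bornology.IsBounded Ω)
    (ho : IsOpen Ω) (hΩ : HasCmBoundary 1 Ω) (hf : ContDiff ℝ 2 f) (hX : ContDiff ℝ 1 X)
    (hXc : HasCompactSupport X) (hY : ContDiff ℝ 1 Y)
    (hYt : ∀ x ∈ frontier Ω, ⟪Y x, tangent Ω x⟫ = 0) :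
    ∫ x in Ω, secondVar f X Y x = ∫ x, boundaryJet f Ω Y x (X x) (fderiv ℝ X x) ∂σ := by
  choose Z hZ h0 h1 using fun n : ℕ =>
    exists_contDiff_approx hX hXc (Nat.one_div_pos_of_nat (α := ℝ) (n := n))
  have hZ1 (n) : ContDiff ℝ 1 (Z n) := (hZ n).of_le one_le_two
  have hcl := hb.isCompact_closure
  have hfr : IsCompact (frontier Ω) := hcl.of_isClosed_subset isClosed_frontier
    frontier_subset_closure
  have := hσ.finite
  have hvol : IsFiniteMeasure (volume.restrict Ω) :=
    ⟨by rw [Measure.restrict_apply_univ]; exact hb.measure_lt_top⟩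
  have hfc := hf.continuous
  have hYc := hY.continuous
  have hf1 : ContDiff ℝ 1 (fderiv ℝ f) := hf.fderiv_right (by norm_num)
  have hf' := hf1.continuous
  have hf'' := hf1.continuous_fderiv one_ne_zero
  have hY' := hY.continuous_fderiv one_ne_zero
  have hν := continuousOn_normal hΩ ho
  have hτ := continuousOn_tangent hΩ ho
  have l1 := tendsto_integral_jet (μ := volume.restrict Ω) hcl
    ((ae_restrict_mem ho.measurableSet).mono fun x hx => subset_closure hx)
    (S := fun x v A => fderiv ℝ (fderiv ℝ f) x (Y x) v + fderiv ℝ f x v * tr (fderiv ℝ Y x)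
      + (fderiv ℝ f x (Y x) * tr A + f x * mixedDet A (fderiv ℝ Y x)))
    (by unfold mixedDet; fun_prop) hX hZ1 h0 h1
  have hS2 : ContinuousOn (fun q : Plane × Plane × (Plane →L[ℝ] Plane) =>
      boundaryJet f Ω Y q.1 q.2.1 q.2.2) (frontier Ω ×ˢ univ) := by
    have hfst : MapsTo (fun q : Plane × Plane × (Plane →L[ℝ] Plane) => q.1)
      (frontier Ω ×ˢ univ) (frontier Ω) := fun q hq => hq.1
    have hν' := hν.comp (continuous_fst.continuousOn) hfst
    have hτ' := hτ.comp (continuous_fst.continuousOn) hfst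
    simp only [Function.comp_def] at hν' hτ'
    unfold boundaryJet
    refine ContinuousOn.mul (ContinuousOn.inner (by fun_prop) hν') (ContinuousOn.add
      (ContinuousOn.mul (by fun_prop) (ContinuousOn.inner ?_ hτ')) (by fun_prop))
    exact ContinuousOn.clm_apply (by fun_prop) hτ'
  have l2 := tendsto_integral_jet hfr hσ.ae_mem_frontier hS2 hX hZ1 h0 h1
  refine tendsto_nhds_unique l1 (l2.congr fun n => ?_)
  exact (hσ.setIntegral_secondVar_of_contDiff_two ho hΩ hf (hZ n) hY hYt).symm

theorem setIntegral_secondVar (hσ : IsBoundaryMeasure Ω σ) (hb : Bornology.IsBounded Ω)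
    (ho : IsOpen Ω) (hΩ : HasCmBoundary 2 Ω) (hf : ContDiff ℝ 2 f) (hX : ContDiff ℝ 1 X)
    (hXc : HasCompactSupport X) (hXt : ∀ x ∈ frontier Ω, ⟪X x, tangent Ω x⟫ = 0)
    (hY : ContDiff ℝ 1 Y) (hYt : ∀ x ∈ frontier Ω, ⟪Y x, tangent Ω x⟫ = 0) :
    ∫ x in Ω, secondVar f X Y x
      = ∫ x, hessianWeight f Ω x * (⟪X x, normal Ω x⟫ * ⟪Y x, normal Ω x⟫) ∂σ := by
  have hΩ1 := hΩ.of_le one_le_two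
  rw [hσ.setIntegral_secondVar_eq_jet hb ho hΩ1 hf hX hXc hY hYt]
  refine integral_congr_ae (hσ.ae_mem_frontier.mono fun x hx => ?_)
  have h1 := inner_eq_zero_of_tangent (norm_normal hΩ1 ho hx) (hXt x hx)
  have h2 : fderiv ℝ f x (X x) = ⟪X x, normal Ω x⟫ * fderiv ℝ f x (normal Ω x) := by
    conv_lhs => rw [h1, map_smul, smul_eq_mul]
  dsimp only
  rw [boundaryJet, inner_fderiv_tangent hΩ ho hx hX hXt, h2, hessianWeight_eq]
  ring

theorem setIntegral_firstVar (hσ : IsBoundaryMeasure Ω σ) (hf : ContDiff ℝ 2 f)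
    (hX : ContDiff ℝ 1 X) :
    ∫ x in Ω, firstVar f X x = ∫ x, f x * ⟪X x, normal Ω x⟫ ∂σ := by
  have h := hσ.divergence _ ((hf.of_le one_le_two : ContDiff ℝ 1 f).smul hX)
  have e (x) : tr (fderiv ℝ (f • X) x) = firstVar f X x := by
    rw [firstVar, add_comm]
    exact tr_fderiv_smul ((hf.differentiable two_ne_zero) x).hasFDerivAt
      ((hX.differentiable one_ne_zero) x).hasFDerivAt
  simp only [e] at h
  rw [h]
  simp only [Pi.smul_apply', real_inner_smul_left]

end IsBoundaryMeasure

/-! ### Shape derivatives of boundary fields -/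

/-- The normal component of a vector field on the boundary. -/
def normalComp {Ω : Set Plane} (v : frontier Ω → Plane) (p : frontier Ω) : ℝ := ⟪v p, normal Ω p⟫

/-- The vector field `v` on the boundary is normal. -/
def IsNormal {Ω : Set Plane} (v : frontier Ω → Plane) : Prop := ∀ p, ⟪v p, tangent Ω p⟫ = 0

/-- The restriction to the boundary, as a type, of a measure on the plane. -/
def onBoundary (Ω : Set Plane) (σ : Measure Plane) : Measure (frontier Ω) := σ.comap Subtype.val

section Boundary

variable {Ω : Set Plane} {σ : Measure Plane} {f : Plane → ℝ}

lemma IsC1Extension.continuous {v : frontier Ω → Plane} {V : Plane → Plane}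
    (h : IsC1Extension v V) : Continuous v := by
  have : v = fun p : frontier Ω => V p := funext fun p => (h.extend p).symm
  rw [this]
  exact h.smooth.continuous.comp continuous_subtype_val

lemma IsC1Extension.inner_tangent {v : frontier Ω → Plane} {V : Plane → Plane}
    (h : IsC1Extension v V) (hv : IsNormal v) : ∀ x ∈ frontier Ω, ⟪V x, tangent Ω x⟫ = 0 :=
  fun x hx => by rw [h.extend ⟨x, hx⟩]; exact hv ⟨x, hx⟩

lemma continuous_normalComp (hΩ : HasCmBoundary 1 Ω) (ho : IsOpen Ω) {v : frontier Ω → Plane}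
    (hv : Continuous v) : Continuous (normalComp v) :=
  hv.inner (continuousOn_iff_continuous_domRestrict.1 (continuousOn_normal hΩ ho))

lemma IsNormal.eq_smul (hΩ : HasCmBoundary 1 Ω) (ho : IsOpen Ω) {v : frontier Ω → Plane}
    (hv : IsNormal v) (p : frontier Ω) : v p = normalComp v p • normal Ω p :=
  inner_eq_zero_of_tangent (norm_normal hΩ ho p.2) (hv p)

namespace IsBoundaryMeasure

lemma integral_onBoundary (hσ : IsBoundaryMeasure Ω σ) (u : Plane → ℝ) :
    ∫ p : frontier Ω, u p ∂onBoundary Ω σ = ∫ x, u x ∂σ := by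
  rw [onBoundary, integral_subtype_comap isClosed_frontier.measurableSet,
    Measure.restrict_eq_self_of_ae_mem hσ.ae_mem_frontier]

lemma onBoundary_apply (A : Set (frontier Ω)) :
    onBoundary Ω σ A = σ (Subtype.val '' A) :=
  comap_subtype_coe_apply isClosed_frontier.measurableSet σ A

lemma boundaryHausdorff_image (A : Set (frontier Ω)) :
    boundaryHausdorff Ω (Subtype.val '' A) = arcLength Ω A := by
  rw [arcLength, comap_subtype_coe_apply isClosed_frontier.measurableSet, boundaryHausdorff,
    Measure.restrict_eq_self _ (by rintro _ ⟨p, -, rfl⟩; exact p.2)]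

lemma isFiniteMeasure_onBoundary (hσ : IsBoundaryMeasure Ω σ) :
    IsFiniteMeasure (onBoundary Ω σ) :=
  ⟨by have := hσ.finite; rw [onBoundary_apply]; exact measure_lt_top σ _⟩

lemma onBoundary_le (hσ : IsBoundaryMeasure Ω σ) :
    ∃ C : NNReal, onBoundary Ω σ ≤ C • arcLength Ω := by
  obtain ⟨C, hC⟩ := hσ.le
  refine ⟨C, Measure.le_iff.2 fun A _ => ?_⟩
  rw [onBoundary_apply, Measure.smul_apply, ← boundaryHausdorff_image]
  exact hC _

lemma arcLength_le (hσ : IsBoundaryMeasure Ω σ) :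
    ∃ C : NNReal, arcLength Ω ≤ C • onBoundary Ω σ := by
  obtain ⟨C, hC⟩ := hσ.ge
  refine ⟨C, Measure.le_iff.2 fun A _ => ?_⟩
  rw [Measure.smul_apply, onBoundary_apply, ← boundaryHausdorff_image]
  exact hC _

lemma isOpenPosMeasure_onBoundary (hσ : IsBoundaryMeasure Ω σ) (ho : IsOpen Ω)
    (hΩ : HasCmBoundary 1 Ω) : (onBoundary Ω σ).IsOpenPosMeasure := by
  refine ⟨fun U hU ⟨p, hp⟩ => ?_⟩
  obtain ⟨T, hT, rfl⟩ := isOpen_induced_iff.1 hU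
  rw [onBoundary_apply, Subtype.image_preimage_coe, inter_comm]
  have h : 0 < σ T := hσ.measure_pos ho hΩ p.2 (hT.mem_nhds hp)
  rw [← Measure.restrict_apply hT.measurableSet,
    Measure.restrict_eq_self_of_ae_mem hσ.ae_mem_frontier]
  exact h.ne'

lemma shapeDeriv_extension (hσ : IsBoundaryMeasure Ω σ) (hb : Bornology.IsBounded Ω)
    (ho : IsOpen Ω) (hf : ContDiff ℝ 2 f) {v : frontier Ω → Plane} {V : Plane → Plane}
    (hV : IsC1Extension v V) :
    HasShapeDeriv (shapeIntegral f) Ω V (∫ p, f p * normalComp v p ∂onBoundary Ω σ) := by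
  have h := hasShapeDeriv_shapeIntegral hf hb ho.measurableSet hV.smooth hV.compact
  rw [hσ.setIntegral_firstVar hf hV.smooth, ← hσ.integral_onBoundary] at h
  simpa only [normalComp, hV.extend] using h

lemma shapeDeriv₂_extension (hσ : IsBoundaryMeasure Ω σ) (hb : Bornology.IsBounded Ω)
    (ho : IsOpen Ω) (hΩ : HasCmBoundary 2 Ω) (hf : ContDiff ℝ 2 f) {v w : frontier Ω → Plane}
    (hv : IsNormal v) (hw : IsNormal w) {V W : Plane → Plane}
    (hV : IsC1Extension v V) (hW : IsC1Extension w W) :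
    HasShapeDeriv₂ (shapeIntegral f) Ω V W
      (∫ p, hessianWeight f Ω p * (normalComp v p * normalComp w p) ∂onBoundary Ω σ) := by
  have h := hasShapeDeriv₂_shapeIntegral hf hb ho hV.smooth hV.compact hW.smooth hW.compact
  rw [hσ.setIntegral_secondVar hb ho hΩ hf hV.smooth hV.compact (hV.inner_tangent hv) hW.smooth
    (hW.inner_tangent hw), ← hσ.integral_onBoundary] at h
  simpa only [normalComp, hV.extend, hW.extend] using h

/-- The computed limit exists for every admissible extension and involves only the boundary values,
so the choice of extension is immaterial. -/
lemma boundaryShapeDeriv_eq (hσ : IsBoundaryMeasure Ω σ) (hb : Bornology.IsBounded Ω)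
    (ho : IsOpen Ω) (hf : ContDiff ℝ 2 f) {v : frontier Ω → Plane} {d : ℝ}
    (h : HasBoundaryShapeDeriv (shapeIntegral f) v d) :
    d = ∫ p, f p * normalComp v p ∂onBoundary Ω σ := by
  obtain ⟨V, hV, hd⟩ := h
  exact hd.unique (hσ.shapeDeriv_extension hb ho hf hV)

lemma boundaryShapeDeriv₂_eq (hσ : IsBoundaryMeasure Ω σ) (hb : Bornology.IsBounded Ω)
    (ho : IsOpen Ω) (hΩ : HasCmBoundary 2 Ω) (hf : ContDiff ℝ 2 f) {v w : frontier Ω → Plane}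
    (hv : IsNormal v) (hw : IsNormal w) {l : ℝ}
    (h : HasBoundaryShapeDeriv₂ (shapeIntegral f) v w l) :
    l = ∫ p, hessianWeight f Ω p * (normalComp v p * normalComp w p) ∂onBoundary Ω σ := by
  obtain ⟨V, W, hV, hW, hl⟩ := h
  exact hl.unique (hσ.shapeDeriv₂_extension hb ho hΩ hf hv hw hV hW)

end IsBoundaryMeasure

/-! ### The explicit Newton direction -/

lemma isNormal_explicitDirection : IsNormal (explicitDirection f Ω) := fun p => by
  rw [explicitDirection, real_inner_smul_left, tangent, inner_self_rot, mul_zero]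

lemma normalComp_explicitDirection (hΩ : HasCmBoundary 1 Ω) (ho : IsOpen Ω) (p : frontier Ω) :
    normalComp (explicitDirection f Ω) p = -(f p / hessianWeight f Ω p) := by
  rw [normalComp, explicitDirection, real_inner_smul_left, real_inner_self_eq_norm_sq,
    norm_normal hΩ ho p.2, one_pow, mul_one]

lemma continuous_hessianWeight (hΩ : HasCmBoundary 2 Ω) (ho : IsOpen Ω) (hf : ContDiff ℝ 2 f) :
    Continuous fun p : frontier Ω => hessianWeight f Ω p :=
  continuousOn_iff_continuous_domRestrict.1 (continuousOn_hessianWeight hΩ ho hf)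

lemma continuous_explicitDirection (hΩ : HasCmBoundary 2 Ω) (ho : IsOpen Ω) (hf : ContDiff ℝ 2 f)
    (hpos : ∀ p ∈ frontier Ω, 0 < hessianWeight f Ω p) :
    Continuous (explicitDirection f Ω) := by
  have h1 : Continuous fun p : frontier Ω => normal Ω p :=
    continuousOn_iff_continuous_domRestrict.1 (continuousOn_normal (hΩ.of_le one_le_two) ho)
  have h2 := hf.continuous.comp (continuous_subtype_val (p := fun x => x ∈ frontier Ω))
  exact ((h2.div (continuous_hessianWeight hΩ ho hf) fun p => (hpos p p.2).ne').neg).smul h1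

end Boundary

/-! ### Vector fields with components in the reproducing kernel Hilbert space -/

section RKHS

variable {Ω : Set Plane} {H : Type*} [NormedAddCommGroup H] [InnerProductSpace ℝ H]
  [RKHS ℝ H (frontier Ω) ℝ] {k : ℕ} {K : Plane → Plane → ℝ}

/-- The map `field` as a linear map. -/
def fieldLM : Sq H →ₗ[ℝ] frontier Ω → Plane where
  toFun := field
  map_add' F G := by ext p i; simp [field]
  map_smul' a F := by ext p i; simp [field]

lemma field_injective : Function.Injective (field : Sq H → frontier Ω → Plane) := by
  intro F G h
  ext i p
  exact congrArg (fun v : Plane => v i) (congrFun h p)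

/-- The normal component of the field of an element of `[H(∂Ω)]²` as a linear map. -/
def normalCompLM : Sq H →ₗ[ℝ] frontier Ω → ℝ where
  toFun F := normalComp (field F)
  map_add' F G := by
    ext p
    have : field (F + G) p = field F p + field G p := congrFun (map_add fieldLM F G) p
    simp [normalComp, this, inner_add_left]
  map_smul' a F := by
    ext p
    have : field (a • F) p = a • field F p := congrFun (map_smul fieldLM a F) p
    simp [normalComp, this, inner_smul_left]

lemma normalCompLM_apply (F : Sq H) : normalCompLM F = normalComp (field F) := rfl

lemma isNormal_of_mem {F : Sq H} (hF : F ∈ normalFields H) : IsNormal (field F) := hF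

lemma IsCkOnBoundary.normal_apply (hΩ : HasCmBoundary (k + 1) Ω) (ho : IsOpen Ω) (j : Fin 2) :
    IsCkOnBoundary k Ω fun x => normal Ω x j := by
  intro p hp
  obtain ⟨Φ, hΦ, heq⟩ := exists_contDiff_normal hΩ ho hp
  refine ⟨fun x => Φ x j, by fun_prop, ?_⟩
  filter_upwards [heq] with x hx
  rw [hx]

lemma IsCkOnBoundary.mul {φ ψ : Plane → ℝ} (hφ : IsCkOnBoundary k Ω φ)
    (hψ : IsCkOnBoundary k Ω ψ) : IsCkOnBoundary k Ω fun x => φ x * ψ x := by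
  intro p hp
  obtain ⟨Φ, hΦ, h1⟩ := hφ p hp
  obtain ⟨Ψ, hΨ, h2⟩ := hψ p hp
  refine ⟨fun x => Φ x * Ψ x, hΦ.mul hΨ, ?_⟩
  filter_upwards [h1, h2] with x hx1 hx2
  rw [hx1, hx2]

lemma IsCkOnBoundary.neg {φ : Plane → ℝ} (hφ : IsCkOnBoundary k Ω φ) :
    IsCkOnBoundary k Ω fun x => -φ x := by
  intro p hp
  obtain ⟨Φ, hΦ, h1⟩ := hφ p hp
  exact ⟨fun x => -Φ x, hΦ.neg, h1.mono fun x hx => congrArg Neg.neg hx⟩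

lemma IsCkOnBoundary.of_contDiff {φ : Plane → ℝ} (hφ : ContDiff ℝ k φ) : IsCkOnBoundary k Ω φ :=
  fun _ _ => ⟨φ, hφ, Eventually.of_forall fun _ => rfl⟩

lemma IsCkOnBoundary.tangent_apply (hΩ : HasCmBoundary (k + 1) Ω) (ho : IsOpen Ω) (j : Fin 2) :
    IsCkOnBoundary k Ω fun x => tangent Ω x j := by
  fin_cases j
  · exact (IsCkOnBoundary.normal_apply hΩ ho 1).neg
  · exact IsCkOnBoundary.normal_apply hΩ ho 0

variable [CompleteSpace H]

lemma KernelAssumption.exists_mul (hK : KernelAssumption (H := H) k K) {φ : Plane → ℝ}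
    (hφ : IsCkOnBoundary k Ω φ) (u : H) : ∃ g : H, ∀ p : frontier Ω, g p = φ p * u p := by
  obtain ⟨c, -, hc⟩ := hK.module
  obtain ⟨g, hg, -⟩ := hc φ hφ u
  exact ⟨g, hg⟩

/-- The multiplier property puts g = r·τ into H; testing the second equation with ψ = g gives ‖g‖ =
0. -/
lemma IsSaddlePoint.mem_normalFields (hK : KernelAssumption (H := H) k K) (ho : IsOpen Ω)
    (hΩ : HasCmBoundary (k + 1) Ω) {x : frontier Ω} {r : Sq H} {q : H}
    (h : IsSaddlePoint x r q) : r ∈ normalFields H := by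
  choose g hg using fun j : Fin 2 =>
    hK.exists_mul (IsCkOnBoundary.tangent_apply hΩ ho j) (r j)
  have hsum (p : frontier Ω) : (g 0 + g 1) p = ⟪field r p, tangent Ω p⟫ := by
    rw [RKHS.coe_add, Pi.add_apply, hg, hg, inner_plane]
    simp [field, mul_comm]
  have h0 : g 0 + g 1 = 0 := inner_self_eq_zero.1 (h.second (g 0 + g 1) _ hsum)
  intro p
  rw [← hsum p, h0, RKHS.coe_zero, Pi.zero_apply]

/-- The difference r - r' is normal, so testing the first equation with it removes the Lagrange
multiplier and leaves ‖r - r'‖² = 0. -/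
lemma IsSaddlePoint.unique (hK : KernelAssumption (H := H) k K) (ho : IsOpen Ω)
    (hΩ : HasCmBoundary (k + 1) Ω) {x : frontier Ω} {r r' : Sq H} {q q' : H}
    (h : IsSaddlePoint x r q) (h' : IsSaddlePoint x r' q') : r = r' := by
  have hm : r - r' ∈ normalFields H :=
    Submodule.sub_mem _ (h.mem_normalFields hK ho hΩ) (h'.mem_normalFields hK ho hΩ)
  have hz (y : frontier Ω) : (0 : H) y = ⟪field (r - r') y, tangent Ω y⟫ := by
    rw [RKHS.coe_zero, Pi.zero_apply]; exact (hm y).symm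
  have h1 := h.first (r - r') 0 hz
  have h2 := h'.first (r - r') 0 hz
  rw [inner_zero_left, add_zero] at h1 h2
  rw [← sub_eq_zero, ← inner_self_eq_zero (𝕜 := ℝ), inner_sub_left, h1, h2, sub_self]

lemma basisSpan_le (hK : KernelAssumption (H := H) k K) (ho : IsOpen Ω)
    (hΩ : HasCmBoundary (k + 1) Ω) (S : Finset (frontier Ω)) :
    basisSpan H S ≤ normalFields H := by
  refine Submodule.span_le.2 ?_
  rintro r ⟨x, -, q, h⟩
  exact h.mem_normalFields hK ho hΩ

/-- Each point of S contributes at most one generator; existence of saddle point solutions plays no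
role. -/
lemma finiteDimensional_basisSpan (hK : KernelAssumption (H := H) k K) (ho : IsOpen Ω)
    (hΩ : HasCmBoundary (k + 1) Ω) (S : Finset (frontier Ω)) :
    FiniteDimensional ℝ (basisSpan H S) := by
  refine FiniteDimensional.span_of_finite ℝ ?_
  have : {r : Sq H | ∃ x ∈ S, ∃ q, IsSaddlePoint x r q}
      = ⋃ x ∈ S, {r | ∃ q, IsSaddlePoint x r q} := by ext; simp
  rw [this]
  refine S.finite_toSet.biUnion fun x _ => Set.Subsingleton.finite ?_
  rintro r ⟨q, h⟩ r' ⟨q', h'⟩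
  exact h.unique hK ho hΩ h'

/-- The normal fields in `[H(∂Ω)]²` contain the fields `|x|² φ ν` with smooth `φ`. -/
lemma exists_mem_normalFields (hK : KernelAssumption (H := H) k K) (ho : IsOpen Ω)
    (hΩ : HasCmBoundary (k + 1) Ω) {φ : Plane → ℝ} (hφ : ContDiff ℝ k φ) :
    ∃ Y ∈ normalFields H, ∀ p : frontier Ω, field Y p = (φ p * ‖(p : Plane)‖ ^ 2) • normal Ω p := by
  choose u hu using hK.identity
  -- Constants need not belong to H, only the coordinates do. Multiplying x_i by φ x_i ν_j and
  -- summing over i produces the factor |x|².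
  have hck (i j : Fin 2) : IsCkOnBoundary k Ω fun x => φ x * x i * normal Ω x j :=
    (IsCkOnBoundary.of_contDiff (by fun_prop)).mul (IsCkOnBoundary.normal_apply hΩ ho j)
  choose g hg using fun i j => hK.exists_mul (hck i j) (u i)
  let Y : Sq H := WithLp.toLp 2 fun j => g 0 j + g 1 j
  have hY (p : frontier Ω) : field Y p = (φ p * ‖(p : Plane)‖ ^ 2) • normal Ω p := by
    ext j
    simp only [field, Y, RKHS.coe_add, Pi.add_apply, hg, hu, PiLp.smul_apply, smul_eq_mul]
    rw [← real_inner_self_eq_norm_sq, inner_plane]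
    ring
  refine ⟨Y, fun p => ?_, hY⟩
  rw [hY, real_inner_smul_left, tangent, inner_self_rot, mul_zero]

end RKHS

/-! ### Weighted L² estimates on the boundary. -/

section Estimate

variable {Ω : Set Plane} {σ : Measure Plane} {f : Plane → ℝ}

lemma compactSpace_frontier (hb : Bornology.IsBounded Ω) : CompactSpace (frontier Ω) :=
  isCompact_iff_compactSpace.1 (hb.isCompact_closure.of_isClosed_subset isClosed_frontier
    frontier_subset_closure)

namespace IsBoundaryMeasure

lemma memLp_onBoundary (hσ : IsBoundaryMeasure Ω σ) (hb : Bornology.IsBounded Ω) {E : Type*}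
    [NormedAddCommGroup E] [SecondCountableTopologyEither (frontier Ω) E] {u : frontier Ω → E}
    (hu : Continuous u) (q : ℝ≥0∞) : MemLp u q (onBoundary Ω σ) := by
  have := compactSpace_frontier hb
  have := hσ.isFiniteMeasure_onBoundary
  obtain ⟨C, hC⟩ := isCompact_univ.exists_bound_of_continuousOn hu.continuousOn
  exact MemLp.of_bound hu.aestronglyMeasurable C (Eventually.of_forall fun p => hC p (mem_univ p))

lemma integrable_onBoundary (hσ : IsBoundaryMeasure Ω σ) (hb : Bornology.IsBounded Ω)
    {u : frontier Ω → ℝ} (hu : Continuous u) : Integrable u (onBoundary Ω σ) :=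
  memLp_one_iff_integrable.1 (hσ.memLp_onBoundary hb hu 1)

lemma integrable_hessianWeight_mul (hσ : IsBoundaryMeasure Ω σ) (hb : Bornology.IsBounded Ω)
    (ho : IsOpen Ω) (hΩ : HasCmBoundary 2 Ω) (hf : ContDiff ℝ 2 f) {a b : frontier Ω → ℝ}
    (ha : Continuous a) (hbc : Continuous b) :
    Integrable (fun p : frontier Ω => hessianWeight f Ω p * (a p * b p)) (onBoundary Ω σ) :=
  hσ.integrable_onBoundary hb ((continuous_hessianWeight hΩ ho hf).mul (ha.mul hbc))

lemma integrable_continuous_mul (hσ : IsBoundaryMeasure Ω σ) (hb : Bornology.IsBounded Ω)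
    (hf : Continuous f) {a : frontier Ω → ℝ} (ha : Continuous a) :
    Integrable (fun p : frontier Ω => f p * a p) (onBoundary Ω σ) :=
  hσ.integrable_onBoundary hb ((hf.comp continuous_subtype_val).mul ha)

/-- Pythagoras in the w-weighted product: b is the best approximation of a, and the bounds m ≤ w ≤ M
convert to the unweighted norm. -/
lemma integral_sq_le_of_orthogonal (hσ : IsBoundaryMeasure Ω σ) (hb : Bornology.IsBounded Ω)
    {w a b y : frontier Ω → ℝ} (hw : Continuous w) (ha : Continuous a) (hbc : Continuous b)
    (hy : Continuous y) {m M : ℝ} (hm : 0 < m) (hmw : ∀ p, m ≤ w p) (hwM : ∀ p, w p ≤ M)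
    (horth : ∫ p, w p * ((a p - b p) * (y p - b p)) ∂onBoundary Ω σ = 0) :
    ∫ p, (a p - b p) ^ 2 ∂onBoundary Ω σ ≤ M / m * ∫ p, (a p - y p) ^ 2 ∂onBoundary Ω σ := by
  have I {u : frontier Ω → ℝ} (hu : Continuous u) := hσ.integrable_onBoundary hb hu
  have h1 : m * ∫ p, (a p - b p) ^ 2 ∂onBoundary Ω σ
      ≤ ∫ p, w p * (a p - b p) ^ 2 ∂onBoundary Ω σ := by
    rw [← integral_const_mul]
    exact integral_mono (I (by fun_prop)) (I (by fun_prop)) fun p =>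
      mul_le_mul_of_nonneg_right (hmw p) (sq_nonneg _)
  have h2 : ∫ p, w p * (a p - b p) ^ 2 ∂onBoundary Ω σ
      ≤ ∫ p, (w p * (a p - y p) ^ 2 + 2 * (w p * ((a p - b p) * (y p - b p)))) ∂onBoundary Ω σ := by
    refine integral_mono (I (by fun_prop)) (I (by fun_prop)) fun p => ?_
    -- Expanding a - y = (a - b) - (y - b), this is the square that is dropped; the cross term
    -- integrates to zero.
    have : 0 ≤ w p * (y p - b p) ^ 2 := mul_nonneg (hm.le.trans (hmw p)) (sq_nonneg _)
    dsimp only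
    linarith [show w p * (a p - y p) ^ 2 + 2 * (w p * ((a p - b p) * (y p - b p)))
      = w p * (a p - b p) ^ 2 + w p * (y p - b p) ^ 2 by ring]
  rw [integral_add (I (by fun_prop)) (I (by fun_prop)), integral_const_mul, horth, mul_zero,
    add_zero] at h2
  have h3 : ∫ p, w p * (a p - y p) ^ 2 ∂onBoundary Ω σ
      ≤ M * ∫ p, (a p - y p) ^ 2 ∂onBoundary Ω σ := by
    rw [← integral_const_mul]
    exact integral_mono (I (by fun_prop)) (I (by fun_prop)) fun p =>
      mul_le_mul_of_nonneg_right (hwM p) (sq_nonneg _)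
  rw [div_mul_eq_mul_div, le_div_iff₀ hm, mul_comm]
  exact h1.trans (h2.trans h3)

lemma eLpNorm_two (hσ : IsBoundaryMeasure Ω σ) (hb : Bornology.IsBounded Ω)
    {v : frontier Ω → Plane} (hv : Continuous v) :
    eLpNorm v 2 (onBoundary Ω σ) = ENNReal.ofReal √(∫ p, ‖v p‖ ^ 2 ∂onBoundary Ω σ) := by
  rw [(hσ.memLp_onBoundary hb hv 2).eLpNorm_eq_integral_rpow_norm two_ne_zero ENNReal.ofNat_ne_top,
    Real.sqrt_eq_rpow]
  simp

lemma eLpNorm_arcLength_le (hσ : IsBoundaryMeasure Ω σ) : ∃ C : NNReal, C ≠ 0 ∧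
    ∀ v : frontier Ω → Plane, eLpNorm v 2 (arcLength Ω) ≤ C * eLpNorm v 2 (onBoundary Ω σ) ∧
      eLpNorm v 2 (onBoundary Ω σ) ≤ C * eLpNorm v 2 (arcLength Ω) := by
  obtain ⟨C₁, h₁⟩ := hσ.arcLength_le
  obtain ⟨C₂, h₂⟩ := hσ.onBoundary_le
  have key {μ ν : Measure (frontier Ω)} {C : NNReal} (h : μ ≤ C • ν) (v : frontier Ω → Plane) :
      eLpNorm v 2 μ ≤ ((C ^ (1 / 2 : ℝ) + 1 : NNReal) : ℝ≥0∞) * eLpNorm v 2 ν := by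
    refine (eLpNorm_mono_measure v h).trans ?_
    rw [eLpNorm_smul_measure_of_ne_top' ENNReal.ofNat_ne_top, ENNReal.smul_def, smul_eq_mul]
    gcongr
    simp
  -- The sum serves both directions; the added ones keep the constant nonzero.
  refine ⟨(C₁ ^ (1 / 2 : ℝ) + 1) + (C₂ ^ (1 / 2 : ℝ) + 1), by positivity, fun v => ⟨?_, ?_⟩⟩
  · refine (key h₁ v).trans ?_
    refine mul_le_mul_left ?_ _
    exact_mod_cast le_self_add
  · refine (key h₂ v).trans ?_
    refine mul_le_mul_left ?_ _
    exact_mod_cast le_add_self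

lemma memLp_arcLength (hσ : IsBoundaryMeasure Ω σ) (hb : Bornology.IsBounded Ω)
    {v : frontier Ω → Plane} (hv : Continuous v) : MemLp v 2 (arcLength Ω) := by
  obtain ⟨C, -, hC⟩ := hσ.eLpNorm_arcLength_le
  exact ⟨hv.aestronglyMeasurable, (hC v).1.trans_lt
    (ENNReal.mul_lt_top ENNReal.coe_lt_top (hσ.memLp_onBoundary hb hv 2).2)⟩

end IsBoundaryMeasure

lemma norm_sub_sq_of_isNormal (hΩ : HasCmBoundary 1 Ω) (ho : IsOpen Ω) {v w : frontier Ω → Plane}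
    (hv : IsNormal v) (hw : IsNormal w) (p : frontier Ω) :
    ‖(v - w) p‖ ^ 2 = (normalComp v p - normalComp w p) ^ 2 := by
  rw [Pi.sub_apply, hv.eq_smul hΩ ho p, hw.eq_smul hΩ ho p, ← sub_smul, norm_smul,
    norm_normal hΩ ho p.2, mul_one, Real.norm_eq_abs, sq_abs]

end Estimate

/-! ### The Newton equation as a weighted L² projection. -/

section Newton

variable {Ω : Set Plane} {σ : Measure Plane} {f : Plane → ℝ} {H : Type*} [NormedAddCommGroup H]
  [InnerProductSpace ℝ H] [RKHS ℝ H (frontier Ω) ℝ]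

lemma SolvesNewton.exists_extension {J : Set Plane → ℝ} {V : Submodule ℝ (Sq H)} {X : Sq H}
    (h : SolvesNewton J V X) {Y : Sq H} (hY : Y ∈ V) : ∃ W, IsC1Extension (field Y) W := by
  obtain ⟨d, ⟨W, hW, -⟩, -⟩ := h.2 Y hY
  exact ⟨W, hW⟩

lemma continuous_normalComp_field (hΩ : HasCmBoundary 1 Ω) (ho : IsOpen Ω) {Y : Sq H}
    (hY : ∃ W, IsC1Extension (field Y) W) : Continuous (normalComp (field Y)) :=
  let ⟨_, hW⟩ := hY
  continuous_normalComp hΩ ho hW.continuous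

/-- The Newton equation in terms of normal components. -/
lemma IsBoundaryMeasure.solvesNewton_iff (hσ : IsBoundaryMeasure Ω σ)
    (hb : Bornology.IsBounded Ω) (ho : IsOpen Ω) (hΩ : HasCmBoundary 2 Ω) (hf : ContDiff ℝ 2 f)
    {V : Submodule ℝ (Sq H)} (hV : V ≤ normalFields H) {X : Sq H} :
    SolvesNewton (shapeIntegral f) V X ↔ X ∈ V ∧ (∀ Y ∈ V, ∃ W, IsC1Extension (field Y) W) ∧
      ∀ Y ∈ V, ∫ p, hessianWeight f Ω p * (normalComp (field X) p * normalComp (field Y) p)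
        ∂onBoundary Ω σ = -∫ p, f p * normalComp (field Y) p ∂onBoundary Ω σ := by
  constructor
  · intro h
    refine ⟨h.1, fun Y hY => h.exists_extension hY, fun Y hY => ?_⟩
    obtain ⟨d, h1, h2⟩ := h.2 Y hY
    rw [← hσ.boundaryShapeDeriv_eq hb ho hf h1,
      ← hσ.boundaryShapeDeriv₂_eq hb ho hΩ hf (hV h.1) (hV hY) h2]
  · rintro ⟨hX, hext, h⟩
    refine ⟨hX, fun Y hY => ?_⟩
    obtain ⟨A, hA⟩ := hext X hX
    obtain ⟨B, hB⟩ := hext Y hY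
    refine ⟨_, ⟨B, hB, hσ.shapeDeriv_extension hb ho hf hB⟩, A, B, hA, hB, ?_⟩
    rw [← h Y hY]
    exact hσ.shapeDeriv₂_extension hb ho hΩ hf (hV hX) (hV hY) hA hB

/-- The weighted form is positive definite on V: a vanishing integral of w(X·ν)² kills the
continuous function X·ν, hence the normal field X. In finite dimension the injective map from V to
its dual is onto. -/
theorem IsBoundaryMeasure.existsUnique_solvesNewton (hσ : IsBoundaryMeasure Ω σ)
    (hb : Bornology.IsBounded Ω) (ho : IsOpen Ω) (hΩ : HasCmBoundary 2 Ω) (hf : ContDiff ℝ 2 f)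
    (hpos : ∀ p ∈ frontier Ω, 0 < hessianWeight f Ω p)
    {V : Submodule ℝ (Sq H)} (hV : V ≤ normalFields H) [FiniteDimensional ℝ V]
    (hext : ∀ Y ∈ V, ∃ W, IsC1Extension (field Y) W) :
    ∃! X : Sq H, SolvesNewton (shapeIntegral f) V X := by
  have hΩ1 := hΩ.of_le one_le_two
  have hw := continuous_hessianWeight hΩ ho hf
  have hn (Y : V) : Continuous (normalCompLM (Y : Sq H)) :=
    continuous_normalComp_field hΩ1 ho (hext Y Y.2)
  have I {a b : frontier Ω → ℝ} (ha : Continuous a) (hb' : Continuous b) :=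
    hσ.integrable_hessianWeight_mul hb ho hΩ hf ha hb'
  let a : V →ₗ[ℝ] V →ₗ[ℝ] ℝ := LinearMap.mk₂ ℝ
    (fun X Y => ∫ p, hessianWeight f Ω p *
      (normalCompLM (X : Sq H) p * normalCompLM (Y : Sq H) p) ∂onBoundary Ω σ)
    (fun X X' Y => by
      rw [← integral_add (I (hn X) (hn Y)) (I (hn X') (hn Y))]
      simp [add_mul, mul_add])
    (fun c X Y => by
      rw [smul_eq_mul, ← integral_const_mul]
      congr 1; ext p; simp; ring)
    (fun X Y Y' => by
      rw [← integral_add (I (hn X) (hn Y)) (I (hn X) (hn Y'))]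
      simp [mul_add])
    (fun c X Y => by
      rw [smul_eq_mul, ← integral_const_mul]
      congr 1; ext p; simp; ring)
  let l : V →ₗ[ℝ] ℝ :=
    { toFun := fun Y => ∫ p, f p * normalCompLM (Y : Sq H) p ∂onBoundary Ω σ
      map_add' := fun Y Y' => by
        rw [← integral_add (hσ.integrable_continuous_mul hb hf.continuous (hn Y))
          (hσ.integrable_continuous_mul hb hf.continuous (hn Y'))]
        simp [mul_add]
      map_smul' := fun c Y => by
        rw [RingHom.id_apply, smul_eq_mul, ← integral_const_mul]
        congr 1; ext p; simp; ring }
  have hinj : Function.Injective a := by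
    rw [← LinearMap.ker_eq_bot, LinearMap.ker_eq_bot']
    intro X hX
    have h0 : ∫ p, hessianWeight f Ω p *
        (normalCompLM (X : Sq H) p * normalCompLM (X : Sq H) p) ∂onBoundary Ω σ = 0 :=
      LinearMap.congr_fun hX X
    have hnn : ∀ p : frontier Ω, 0 ≤ hessianWeight f Ω p *
        (normalCompLM (X : Sq H) p * normalCompLM (X : Sq H) p) :=
      fun p => mul_nonneg (hpos p p.2).le (mul_self_nonneg _)
    rw [integral_eq_zero_iff_of_nonneg hnn (I (hn X) (hn X))] at h0
    have := hσ.isOpenPosMeasure_onBoundary ho hΩ1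
    have h1 := ((hw.mul ((hn X).mul (hn X))).ae_eq_iff_eq _ continuous_const).1 h0
    have h2 : field (X : Sq H) = field (0 : Sq H) := by
      funext p
      have h3 : hessianWeight f Ω p *
        (normalCompLM (X : Sq H) p * normalCompLM (X : Sq H) p) = 0 := congrFun h1 p
      have h4 : normalComp (field (X : Sq H)) p = 0 := by
        rw [normalCompLM_apply] at h3
        simpa [(hpos p p.2).ne'] using h3
      rw [(isNormal_of_mem (hV X.2)).eq_smul hΩ1 ho p, h4, zero_smul]
      exact (congrFun (map_zero (fieldLM (Ω := Ω) (H := H))) p).symm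
    exact Subtype.ext (field_injective h2)
  have hsurj : Function.Surjective a :=
    (LinearMap.injective_iff_surjective_of_finrank_eq_finrank
      (Subspace.dual_finrank_eq (K := ℝ) (V := V)).symm).1 hinj
  obtain ⟨X, hX⟩ := hsurj (-l)
  refine ⟨X, (hσ.solvesNewton_iff hb ho hΩ hf hV).2 ⟨X.2, hext, fun Y hY => ?_⟩, fun X' hX' => ?_⟩
  · exact LinearMap.congr_fun hX ⟨Y, hY⟩
  · obtain ⟨hX'V, -, h⟩ := (hσ.solvesNewton_iff hb ho hΩ hf hV).1 hX'
    have : a ⟨X', hX'V⟩ = a X := by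
      rw [hX]
      exact LinearMap.ext fun Y => h Y Y.2
    exact congrArg Subtype.val (hinj this)

/-- Testing with φ|x|²ν for all smooth φ shows that |x|²(w X·ν + f) vanishes σ-a.e. The origin is a
σ-null point, so the factor |x|² can be divided out almost everywhere and continuity recovers every
point. -/
theorem IsBoundaryMeasure.field_eq_explicitDirection [CompleteSpace H]
    (hσ : IsBoundaryMeasure Ω σ)
    (hb : Bornology.IsBounded Ω) (ho : IsOpen Ω) (hΩ : HasCmBoundary 2 Ω) (hf : ContDiff ℝ 2 f)
    (hpos : ∀ p ∈ frontier Ω, 0 < hessianWeight f Ω p)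
    {k : ℕ} (hΩk : HasCmBoundary (k + 1) Ω) {K : Plane → Plane → ℝ}
    (hK : KernelAssumption (H := H) k K) {X : Sq H}
    (hX : SolvesNewton (shapeIntegral f) (normalFields H) X) :
    field X = explicitDirection f Ω := by
  have hΩ1 := hΩ.of_le one_le_two
  obtain ⟨hXn, hext, heq⟩ := (hσ.solvesNewton_iff hb ho hΩ hf le_rfl).1 hX
  obtain ⟨V, hV⟩ := hext X hXn
  have hXc := continuous_normalComp hΩ1 ho hV.continuous
  let u (x : Plane) : ℝ := hessianWeight f Ω x * ⟪V x, normal Ω x⟫ + f x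
  have hu : ContinuousOn u (frontier Ω) :=
    ((continuousOn_hessianWeight hΩ ho hf).mul
      (hV.smooth.continuous.continuousOn.inner (continuousOn_normal hΩ1 ho))).add
      hf.continuous.continuousOn
  have hup (p : frontier Ω) : u p = hessianWeight f Ω p * normalComp (field X) p + f p := by
    simp only [u, normalComp, hV.extend]
  have hu2 : ContinuousOn (fun x => ‖x‖ ^ 2 * u x) (frontier Ω) :=
    (by fun_prop : Continuous fun x : Plane => ‖x‖ ^ 2).continuousOn.mul hu
  have hae : ∀ᵐ x ∂σ, ‖x‖ ^ 2 * u x = 0 := by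
    refine ae_eq_zero_of_integral_contDiff_smul_eq_zero (hσ.integrable hb hu2).locallyIntegrable
      fun φ hφ _ => ?_
    obtain ⟨Y, hY, hYp⟩ := exists_mem_normalFields hK ho hΩk
      (hφ.of_le (by exact_mod_cast le_top) : ContDiff ℝ k φ)
    have hYn (p : frontier Ω) : normalComp (field Y) p = φ p * ‖(p : Plane)‖ ^ 2 := by
      rw [normalComp, hYp, real_inner_smul_left, real_inner_self_eq_norm_sq,
        norm_normal hΩ1 ho p.2, one_pow, mul_one]
    have hYc := continuous_normalComp_field hΩ1 ho (hext Y hY)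
    have h := heq Y hY
    rw [eq_neg_iff_add_eq_zero, ← integral_add
      (hσ.integrable_hessianWeight_mul hb ho hΩ hf hXc hYc)
      (hσ.integrable_continuous_mul hb hf.continuous hYc)] at h
    rw [← hσ.integral_onBoundary, ← h]
    congr 1
    funext p
    rw [hup, hYn, smul_eq_mul]
    ring
  have h0 (x : Plane) (hx : x ∈ frontier Ω) : ‖x‖ ^ 2 * u x = 0 :=
    hσ.eq_zero_of_ae ho hΩ1 hu2 hae hx
  have hne : ∀ᵐ x ∂σ, x ≠ 0 :=
    measure_mono_null (fun x hx => not_not.1 hx) (hσ.measure_singleton 0)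
  have hu0 : ∀ᵐ x ∂σ, u x = 0 := by
    filter_upwards [hne, hσ.ae_mem_frontier] with x hx hxf
    simpa [hx] using h0 x hxf
  funext p
  have h1 : u p = 0 := hσ.eq_zero_of_ae ho hΩ1 hu hu0 p.2
  rw [hup] at h1
  have h2 : normalComp (field X) p = -(f p / hessianWeight f Ω p) := by
    have := (hpos p p.2).ne'
    field_simp
    linarith
  rw [(isNormal_of_mem hXn).eq_smul hΩ1 ho p, h2, explicitDirection]

/-- The explicit direction E satisfies w E·ν = -f pointwise, so E - X is w-orthogonal to V whether
or not E belongs to the Hilbert space. Best approximation then applies with constants determined by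
w and σ alone. -/
theorem IsBoundaryMeasure.exists_eLpNorm_le (hσ : IsBoundaryMeasure Ω σ)
    (hb : Bornology.IsBounded Ω) (ho : IsOpen Ω) (hΩ : HasCmBoundary 2 Ω) (hf : ContDiff ℝ 2 f)
    (hpos : ∀ p ∈ frontier Ω, 0 < hessianWeight f Ω p) :
    ∃ c : ℝ, 0 < c ∧ ∀ (H : Type*) [NormedAddCommGroup H] [InnerProductSpace ℝ H]
      [RKHS ℝ H (frontier Ω) ℝ] (V : Submodule ℝ (Sq H)), V ≤ normalFields H →
      ∀ X, SolvesNewton (shapeIntegral f) V X → ∀ Y ∈ V,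
        eLpNorm (explicitDirection f Ω - field X) 2 (arcLength Ω) ≤
          ENNReal.ofReal c * eLpNorm (explicitDirection f Ω - field Y) 2 (arcLength Ω) := by
  have hΩ1 := hΩ.of_le one_le_two
  have hw := continuous_hessianWeight hΩ ho hf
  have := compactSpace_frontier hb
  obtain ⟨m, hm, hmw⟩ := isCompact_univ.exists_forall_le' hw.continuousOn
    fun p _ => hpos p p.2
  obtain ⟨M, hM⟩ := isCompact_univ.exists_bound_of_continuousOn hw.continuousOn
  obtain ⟨C, hC, hCle⟩ := hσ.eLpNorm_arcLength_le
  -- The maximum with 1 ensures that the final constant is positive.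
  set M' := max M 1
  have hM' : 0 < M' := lt_max_of_lt_right one_pos
  have hC0 : (0 : ℝ) < C := NNReal.coe_pos.2 (pos_iff_ne_zero.2 hC)
  -- √(M'/m) is the quasi-optimality constant in L²(σ); each factor C is one change between σ and
  -- arc length.
  refine ⟨C * √(M' / m) * C, by positivity, ?_⟩
  intro H _ _ _ V hV X hX Y hY
  obtain ⟨hXV, hext, heq⟩ := (hσ.solvesNewton_iff hb ho hΩ hf hV).1 hX
  have hEc := continuous_explicitDirection hΩ ho hf hpos
  have hE := continuous_normalComp hΩ1 ho hEc
  have hXc := continuous_normalComp_field hΩ1 ho (hext X hXV)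
  have hYc := continuous_normalComp_field hΩ1 ho (hext Y hY)
  have hX0 : Continuous (field X) := let ⟨_, h⟩ := hext X hXV; h.continuous
  have hY0 : Continuous (field Y) := let ⟨_, h⟩ := hext Y hY; h.continuous
  have horth : ∫ p, hessianWeight f Ω p * ((normalComp (explicitDirection f Ω) p
      - normalComp (field X) p) * (normalComp (field Y) p - normalComp (field X) p))
      ∂onBoundary Ω σ = 0 := by
    -- Galerkin orthogonality: the test field Y - X again lies in V.
    have h := heq (Y - X) (V.sub_mem hY hXV)
    have hD := continuous_normalComp_field hΩ1 ho (hext (Y - X) (V.sub_mem hY hXV))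
    have hsub (p) : normalComp (field (Y - X)) p
        = normalComp (field Y) p - normalComp (field X) p :=
      congrFun (map_sub normalCompLM Y X) p
    have e : ∀ p : frontier Ω, hessianWeight f Ω p * ((normalComp (explicitDirection f Ω) p
      - normalComp (field X) p) * (normalComp (field Y) p - normalComp (field X) p))
      = -(f p * normalComp (field (Y - X)) p) - hessianWeight f Ω p *
        (normalComp (field X) p * normalComp (field (Y - X)) p) := by
      intro p
      have := (hpos p p.2).ne'
      rw [hsub, normalComp_explicitDirection hΩ1 ho]
      field_simp
    simp only [e]
    rw [integral_sub (hσ.integrable_continuous_mul hb hf.continuous hD).fun_neg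
      (hσ.integrable_hessianWeight_mul hb ho hΩ hf hXc hD), h, integral_neg, sub_self]
  have key := hσ.integral_sq_le_of_orthogonal hb hw hE hXc hYc hm (fun p => hmw p (mem_univ p))
    (fun p => (le_abs_self _).trans ((hM p (mem_univ p)).trans (le_max_left M 1))) horth
  have h2 : eLpNorm (explicitDirection f Ω - field X) 2 (onBoundary Ω σ) ≤
      ENNReal.ofReal √(M' / m) *
        eLpNorm (explicitDirection f Ω - field Y) 2 (onBoundary Ω σ) := by
    rw [hσ.eLpNorm_two hb (hEc.sub hX0), hσ.eLpNorm_two hb (hEc.sub hY0),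
      ← ENNReal.ofReal_mul (Real.sqrt_nonneg _), ← Real.sqrt_mul (by positivity)]
    refine ENNReal.ofReal_le_ofReal (Real.sqrt_le_sqrt ?_)
    simpa only [norm_sub_sq_of_isNormal hΩ1 ho isNormal_explicitDirection
      (isNormal_of_mem (hV hXV)), norm_sub_sq_of_isNormal hΩ1 ho isNormal_explicitDirection
      (isNormal_of_mem (hV hY))] using key
  calc eLpNorm (explicitDirection f Ω - field X) 2 (arcLength Ω)
      ≤ C * eLpNorm (explicitDirection f Ω - field X) 2 (onBoundary Ω σ) := (hCle _).1
    _ ≤ C * (ENNReal.ofReal √(M' / m) *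
          (C * eLpNorm (explicitDirection f Ω - field Y) 2 (arcLength Ω))) := by
        gcongr
        exact h2.trans (by gcongr; exact (hCle _).2)
    _ = _ := by
        rw [ENNReal.ofReal_mul (by positivity), ENNReal.ofReal_mul (by positivity),
          ENNReal.ofReal_coe_nnreal]
        ring

end Newton

end ShapeNewton

end

theorem mainTheorem6 (Ω : Set ShapeNewton.Plane) (hne : Ω.Nonempty)
    (hbdd : Bornology.IsBounded Ω) (hopen : IsOpen Ω) (hΩ : ShapeNewton.HasCmBoundary 2 Ω)
    (f : ShapeNewton.Plane → ℝ) (hf : ContDiff ℝ 2 f)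
    (hpos : ∀ p ∈ frontier Ω, 0 < ShapeNewton.hessianWeight f Ω p) :
    ∃ c : ℝ, 0 < c ∧
      ∀ (k : ℕ), 1 ≤ k → ShapeNewton.HasCmBoundary (k + 1) Ω →
      ∀ (K : ShapeNewton.Plane → ShapeNewton.Plane → ℝ)
        (H : Type*) [NormedAddCommGroup H] [InnerProductSpace ℝ H] [CompleteSpace H]
        [RKHS ℝ H (frontier Ω) ℝ],
        ShapeNewton.KernelAssumption (H := H) k K →
        (∀ X : ShapeNewton.Sq H,
          ShapeNewton.SolvesNewton (ShapeNewton.shapeIntegral f) (ShapeNewton.normalFields H) X →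
          ShapeNewton.field X = ShapeNewton.explicitDirection f Ω) ∧
        ∀ S : Finset (frontier Ω),
          ((∀ F ∈ ShapeNewton.basisSpan H S,
              ∃ V, ShapeNewton.IsC1Extension (ShapeNewton.field F) V) →
            ∃! Xh : ShapeNewton.Sq H,
              ShapeNewton.SolvesNewton (ShapeNewton.shapeIntegral f)
                (ShapeNewton.basisSpan H S) Xh) ∧
          ∀ Xh : ShapeNewton.Sq H,
            ShapeNewton.SolvesNewton (ShapeNewton.shapeIntegral f)
              (ShapeNewton.basisSpan H S) Xh →
            ∀ Xν : frontier Ω → ShapeNewton.Plane, ShapeNewton.IsNewtonDirection H f Xν →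
              MemLp Xν 2 (ShapeNewton.arcLength Ω) ∧
              eLpNorm (Xν - ShapeNewton.field Xh) 2 (ShapeNewton.arcLength Ω) ≤
                ENNReal.ofReal c * ⨅ Y ∈ ShapeNewton.basisSpan H S,
                  eLpNorm (Xν - ShapeNewton.field Y) 2 (ShapeNewton.arcLength Ω) := by
  -- Both σ and c are fixed before k, the kernel and S, so c depends only on f and `Ω`.
  obtain ⟨σ, hσ⟩ := ShapeNewton.exists_isBoundaryMeasure hbdd hopen (hΩ.of_le one_le_two)
  obtain ⟨c, hc, hle⟩ := hσ.exists_eLpNorm_le hbdd hopen hΩ hf hpos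
  refine ⟨c, hc, ?_⟩
  intro k _ hΩk K H _ _ _ _ hK
  have h1 (X : ShapeNewton.Sq H) (hX : ShapeNewton.SolvesNewton (ShapeNewton.shapeIntegral f)
      (ShapeNewton.normalFields H) X) :=
    hσ.field_eq_explicitDirection hbdd hopen hΩ hf hpos hΩk hK hX
  refine ⟨h1, fun S => ⟨fun hext => ?_, fun Xh hXh Xν hXν => ?_⟩⟩
  · have := ShapeNewton.finiteDimensional_basisSpan hK hopen hΩk S
    exact hσ.existsUnique_solvesNewton hbdd hopen hΩ hf hpos
      (ShapeNewton.basisSpan_le hK hopen hΩk S) hext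
  · have hX : Xν = ShapeNewton.explicitDirection f Ω := by
      rcases hXν with ⟨X, hX, rfl⟩ | h
      · exact h1 X hX
      · exact h
    subst hX
    refine ⟨hσ.memLp_arcLength hbdd (ShapeNewton.continuous_explicitDirection hΩ hopen hf hpos), ?_⟩
    -- The infimum over `Y ∈ basisSpan H S` is ⊤ for Y outside the span; a nonzero finite factor
    -- moves inside such infima.
    have hc0 : ENNReal.ofReal c ≠ 0 := (ENNReal.ofReal_pos.2 hc).ne'
    rw [ENNReal.mul_iInf_of_ne hc0 ENNReal.ofReal_ne_top]
    refine le_iInf fun Y => ?_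
    rw [ENNReal.mul_iInf_of_ne hc0 ENNReal.ofReal_ne_top]
    exact le_iInf fun hY => hle H _ (ShapeNewton.basisSpan_le hK hopen hΩk S) Xh hXh Y hY
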